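/- Let $Q$ be a smooth $n$-dimensional manifold with a Riemannian metric (the kinetic energy metric), let $D\subset TQ$ be a smooth vector subbundle of rank $r$ (the constraints) and let $U\in C^\infty(Q)$ be a potential energy. Let $G$ be a Lie group acting smoothly, freely and properly on $Q$ by isometries that preserve $D$ and $U$, and suppose that $T_qQ=D_q\oplus(\mathfrak g\cdot q)$ for all $q\in Q$, where $\mathfrak g\cdot q$ is the tangent space of the $G$-orbit through $q$. These data form a $G$-Chaplygin system. Write $\mathcal P:TQ\to D$ for the orthogonal projector, $i_D:D\hookrightarrow TQ$ for the inclusion, $h(\beta)=\tfrac12\|\beta\|^2+U$ for the Hamiltonian on $T^*Q$, and $h_c=h\circ\mathcal P^*$ for the constrained Hamiltonian on $D^*$. The nonholonomic dynamics is the vector field $X_{nh}$ on $D^*$ given by $X_{nh}[\varphi]=\{\varphi,h_c\}_{D^*}$, where $\{\varphi,\psi\}_{D^*}=\{\varphi\circ i_D^*,\psi\circ i_D^*\}_{T^*Q}\circ\mathcal P^*$. Let $S=Q/G$ with orbit projection $\pi:Q\to S$, and identify $D^*/G$ with $T^*S$ by $[\beta]\mapsto \beta\circ\mathrm{hor}_q$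 for $\beta\in D_q^*$, where $\mathrm{hor}_q=(T_q\pi|_{D_q})^{-1}$. The vector field $X_{nh}$ projects to a smooth vector field $\overline X_{nh}$ on $T^*S$ (the reduced equations of motion). Let $\nu=\Omega_{can}^r$ be the Liouville volume form on $T^*S$ and $\tau_S:T^*S\to S$ the bundle projection. A basic measure is a volume form $\mu=(f\circ\tau_S)\,\nu$ with $f\in C^\infty(S)$, $f>0$; it is preserved by the system if $\mathcal L_{\overline X_{nh}}\mu=0$. Claim: let $V\in C^\infty(Q)$ be any $G$-invariant function. If the $G$-Chaplygin system with potential $U$ preserves a basic measure $\mu$, then the $G$-Chaplygin system with the same metric, constraints and group action, but with potential $U+V$, preserves the same basic measure $\mu$. -/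

import Mathlib

open scoped Manifold ContDiff
open Set

noncomputable section

namespace Chaplygin

/-! ### Differential forms and Lie derivatives on a manifold -/

section Forms

variable {E H M : Type*} [NormedAddCommGroup E] [NormedSpace ℝ E] [TopologicalSpace H]
  (I : ModelWithCorners ℝ E H) [TopologicalSpace M] [ChartedSpace H M]

/-- Exterior derivative of a differential `k`-form `η` on a manifold: at `x`, transport `η` to the
model vector space with the preferred chart at `x`, differentiate there, and pull the result
back. -/
def extDerivForm {k : ℕ} (η : (x : M) → (TangentSpace I x) [⋀^Fin k]→L[ℝ] ℝ) (x : M) :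
    (TangentSpace I x) [⋀^Fin (k + 1)]→L[ℝ] ℝ :=
  (extDerivWithin (𝕜 := ℝ) (E := E) (F := ℝ)
    (fun y : E => (η ((extChartAt I x).symm y)).compContinuousLinearMap
      (mfderivWithin 𝓘(ℝ, E) I (extChartAt I x).symm (range I) y))
    (range I) (extChartAt I x x)).compContinuousLinearMap
      (mfderiv I 𝓘(ℝ, E) (extChartAt I x) x)

/-- Lie derivative `L_X η` of a differential form `η` along a vector field `X`, evaluated at `x` on
the vectors `v`. With `η'`, `X'`, `w` the expressions of `η`, `X`, `v` in the preferred chart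
`extChartAt I x`, this is the usual local formula
`(L_X η)(w) = X'[η'(w)] + ∑ i, η'(w 1, …, (∂X'/∂w i), …)`, the vectors `w` being held constant. -/
def lieDerivForm {ι : Type*} [Fintype ι] [DecidableEq ι] (X : (x : M) → TangentSpace I x)
    (η : (x : M) → (TangentSpace I x) [⋀^ι]→ₗ[ℝ] ℝ) (x : M) (v : ι → TangentSpace I x) : ℝ :=
  let η' : E → (ι → E) → ℝ := fun y w => η ((extChartAt I x).symm y)
    (fun i => mfderivWithin 𝓘(ℝ, E) I (extChartAt I x).symm (range I) y (w i))
  let X' : E → E := VectorField.mpullbackWithin 𝓘(ℝ, E) I (extChartAt I x).symm X (range I)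
  let w : ι → E := fun i => mfderiv I 𝓘(ℝ, E) (extChartAt I x) x (v i)
  fderivWithin ℝ (fun y => η' y w) (range I) (extChartAt I x x) (X' (extChartAt I x x)) +
    ∑ i, η' (extChartAt I x x) (Function.update w i
      (fderivWithin ℝ X' (range I) (extChartAt I x x) (w i)))

end Forms

theorem prod_update {V : Type*} [AddCommGroup V] [Module ℝ V] (η : V [⋀^Fin 2]→ₗ[ℝ] ℝ) {r : ℕ}
    [DecidableEq (Fin r × Fin 2)] (v : Fin r × Fin 2 → V) (p : Fin r × Fin 2) (z : V) :
    ∏ i, η (fun j => Function.update v p z (i, j)) =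
      η (Function.update (fun j => v (p.1, j)) p.2 z) *
        ∏ i ∈ Finset.univ.erase p.1, η (fun j => v (i, j)) := by
  obtain ⟨i₀, j₀⟩ := p
  rw [← Finset.mul_prod_erase _ _ (Finset.mem_univ i₀)]
  congr 1
  · congr 1
    ext j
    simp [Function.update_apply]
  · refine Finset.prod_congr rfl fun i hi => ?_
    congr 1
    ext j
    simp [Finset.ne_of_mem_erase hi]

/-- The `r`-th exterior power `η ∧ ⋯ ∧ η` of an alternating 2-form `η`, as an alternating form in
`2 r` vectors; the arguments are indexed by `Fin r × Fin 2` (in lexicographic order), and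
`(η ∧ ⋯ ∧ η)(v) = 2⁻ʳ ∑_σ sign(σ) ∏ i, η (v (σ (i, 0))) (v (σ (i, 1)))`. -/
def wedgePow {V : Type*} [AddCommGroup V] [Module ℝ V] (η : V [⋀^Fin 2]→ₗ[ℝ] ℝ) (r : ℕ) :
    V [⋀^(Fin r × Fin 2)]→ₗ[ℝ] ℝ :=
  ((2 : ℝ) ^ r)⁻¹ • MultilinearMap.alternatization
    ({ toFun := fun v => ∏ i : Fin r, η (fun j => v (i, j))
       map_update_add' := fun v p x y => by
         simp only [prod_update, η.map_update_add, add_mul]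
       map_update_smul' := fun v p c x => by
         simp only [prod_update, η.map_update_smul, smul_eq_mul, mul_assoc] } :
      MultilinearMap ℝ (fun _ : Fin r × Fin 2 => V) ℝ)

/-! ### Cotangent bundles -/

/-- The model space `ℝᵐ`. -/
abbrev Eu (m : ℕ) : Type := EuclideanSpace ℝ (Fin m)

section Cotangent

variable (m : ℕ) (M : Type*) [TopologicalSpace M] [ChartedSpace (Eu m) M]
  [IsManifold (𝓡 m) ∞ M]

/-- The cotangent bundle `T*M` of an `m`-dimensional manifold. -/
abbrev Cotangent : Type _ :=
  Bundle.TotalSpace (Eu m →L[ℝ] ℝ) (fun x : M => TangentSpace (𝓡 m) x →L[ℝ] Bundle.Trivial M ℝ x)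

/-- The model with corners of `T*M`. -/
abbrev cotModel : ModelWithCorners ℝ (Eu m × (Eu m →L[ℝ] ℝ)) (ModelProd (Eu m) (Eu m →L[ℝ] ℝ)) :=
  (𝓡 m).prod 𝓘(ℝ, Eu m →L[ℝ] ℝ)

variable {M}

/-- The Liouville 1-form `λ(α)(v) = α(Tτ v)`. -/
def liouvilleForm (α : Cotangent m M) : (TangentSpace (cotModel m) α) [⋀^Fin 1]→L[ℝ] ℝ :=
  ContinuousAlternatingMap.ofSubsingleton ℝ (TangentSpace (cotModel m) α) ℝ (0 : Fin 1)
    (α.2.comp (mfderiv (cotModel m) (𝓡 m) (fun a : Cotangent m M => a.1) α))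

/-- The canonical symplectic form `Ω_can = -dλ`. -/
def omegaCan (α : Cotangent m M) : (TangentSpace (cotModel m) α) [⋀^Fin 2]→L[ℝ] ℝ :=
  -extDerivForm (cotModel m) (liouvilleForm m) α

/-- The Liouville volume form `ν = Ω_canᵐ` on `T*M`. -/
def liouvilleVolume (α : Cotangent m M) :
    (TangentSpace (cotModel m) α) [⋀^(Fin m × Fin 2)]→ₗ[ℝ] ℝ :=
  wedgePow (omegaCan m α).toAlternatingMap m

/-- The basic volume form `(f ∘ τ) ν` on `T*M`, for a function `f` on `M`. -/
def basicVolume (f : M → ℝ) (α : Cotangent m M) :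
    (TangentSpace (cotModel m) α) [⋀^(Fin m × Fin 2)]→ₗ[ℝ] ℝ :=
  f α.1 • liouvilleVolume m α

/-- The value at `α` of the Hamiltonian vector field of `φ`: the vector `X` with
`Ω_can(X, ·) = dφ`. -/
def hamVec (φ : Cotangent m M → ℝ) (α : Cotangent m M) : TangentSpace (cotModel m) α :=
  Classical.epsilon fun X : TangentSpace (cotModel m) α =>
    ∀ V : TangentSpace (cotModel m) α,
      omegaCan m α ![X, V] = mfderiv (cotModel m) 𝓘(ℝ, ℝ) φ α V

/-- The canonical Poisson bracket `{φ, ψ} = Ω_can(X_φ, X_ψ)` on `T*M`; it satisfies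
`{sⁱ, p_j} = δⁱ_j` in canonical coordinates. -/
def poisson (φ ψ : Cotangent m M → ℝ) (α : Cotangent m M) : ℝ :=
  omegaCan m α ![hamVec m φ α, hamVec m ψ α]

end Cotangent

/-! ### Chaplygin systems -/

/-- A nonholonomic `G`-Chaplygin system on the configuration manifold `Q`, together with its shape
space `S = Q/G`. (The group acts freely and properly by smooth maps, which is expressed by the type
classes on `G` and `Q` in the theorem; `S` and `π` are the orbit space and the orbit projection,
where the smooth structure of `S` is the one for which `π` is a submersion. Neither `2 ≤ r < n` nor
the non-integrability of the constraint distribution is imposed.) -/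
structure System (n d r : ℕ) (Q G S : Type*)
    [TopologicalSpace Q] [ChartedSpace (Eu n) Q] [IsManifold (𝓡 n) ∞ Q]
    [TopologicalSpace G] [ChartedSpace (Eu d) G] [Group G] [MulAction G Q]
    [TopologicalSpace S] [ChartedSpace (Eu r) S] where
  /-- The kinetic energy metric. -/
  metric : Bundle.ContMDiffRiemannianMetric (𝓡 n) ∞ (Eu n) (fun q : Q => TangentSpace (𝓡 n) q)
  /-- The potential energy. -/
  potential : Q → ℝ
  potential_smooth : ContMDiff (𝓡 n) 𝓘(ℝ, ℝ) ∞ potential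
  /-- The constraint distribution: a smooth subbundle of `TQ` of rank `r`, that is, a family of
  subspaces that has local frames consisting of `r` smooth vector fields. -/
  D : (q : Q) → Submodule ℝ (TangentSpace (𝓡 n) q)
  D_smooth : ∀ q₀ : Q, ∃ (N : Set Q) (e : Fin r → (q : Q) → TangentSpace (𝓡 n) q),
    IsOpen N ∧ q₀ ∈ N ∧
    (∀ i, ContMDiffOn (𝓡 n) (𝓡 n).tangent ∞
      (fun q => (⟨q, e i q⟩ : TangentBundle (𝓡 n) Q)) N) ∧
    ∀ q ∈ N, LinearIndependent ℝ (fun i => e i q) ∧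
      Submodule.span ℝ (range fun i => e i q) = D q
  /-- The group acts by isometries. -/
  metric_invariant : ∀ (g : G) (q : Q) (u v : TangentSpace (𝓡 n) q),
    metric.inner (g • q) (mfderiv (𝓡 n) (𝓡 n) (fun q' : Q => g • q') q u)
      (mfderiv (𝓡 n) (𝓡 n) (fun q' : Q => g • q') q v) = metric.inner q u v
  /-- The potential is invariant. -/
  potential_invariant : ∀ (g : G) (q : Q), potential (g • q) = potential q
  /-- The constraint distribution is invariant: `Tg(D_q) = D_{g q}`. -/
  D_invariant : ∀ (g : G) (q : Q),
    (D q).map (mfderiv (𝓡 n) (𝓡 n) (fun q' : Q => g • q') q).toLinearMap = D (g • q)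
  /-- The Chaplygin condition `T_qQ = D_q ⊕ 𝔤·q`, where `𝔤·q` is the tangent space of the orbit,
  i.e. the image of the derivative at `1` of the orbit map. -/
  splitting : ∀ q : Q, IsCompl (D ((1 : G) • q))
    (LinearMap.range (mfderiv (𝓡 d) (𝓡 n) (fun g : G => g • q) 1).toLinearMap)
  /-- The orbit projection. -/
  π : Q → S
  π_surjective : Function.Surjective π
  π_eq_iff : ∀ q q' : Q, π q = π q' ↔ ∃ g : G, g • q = q'
  π_submersion : Manifold.IsSubmersion (𝓡 n) (𝓡 r) ∞ π

namespace System

variable {n d r : ℕ} {Q G S : Type*}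
  [TopologicalSpace Q] [ChartedSpace (Eu n) Q] [IsManifold (𝓡 n) ∞ Q]
  [TopologicalSpace G] [ChartedSpace (Eu d) G] [Group G] [MulAction G Q]
  [TopologicalSpace S] [ChartedSpace (Eu r) S]

/-- The system obtained by adding the `G`-invariant potential `V`; metric, constraints and group
action stay the same. -/
def addPotential (C : System n d r Q G S) (V : Q → ℝ) (hV : ContMDiff (𝓡 n) 𝓘(ℝ, ℝ) ∞ V)
    (hVG : ∀ (g : G) (q : Q), V (g • q) = V q) : System n d r Q G S :=
  { C with
    potential := fun q => C.potential q + V q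
    potential_smooth := C.potential_smooth.add hV
    potential_invariant := fun g q => by rw [C.potential_invariant, hVG] }

variable (C : System n d r Q G S)

/-- The dual bundle `D*` of the constraint distribution. -/
abbrev DDual : Type _ := Σ q : Q, (C.D q →L[ℝ] ℝ)

/-- The metric orthogonal projection `𝒫 : T_qQ → D_q`: restricted to `D_q`, the covector
`⟨v, ·⟩` is represented by a unique vector of `D_q`, which is `𝒫 v`. -/
def proj (q : Q) : TangentSpace (𝓡 n) q →L[ℝ] C.D q :=
  ContinuousLinearMap.comp
    (((ContinuousLinearMap.precomp ℝ (C.D q).subtypeL).comp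
      (C.metric.inner q)).comp (C.D q).subtypeL).inverse
    ((ContinuousLinearMap.precomp ℝ (C.D q).subtypeL).comp (C.metric.inner q))

/-- The horizontal lift `T_{π(q)}S → D_q`, the inverse of the restriction of `T_qπ` to `D_q`. -/
def hor (q : Q) : TangentSpace (𝓡 r) (C.π q) →L[ℝ] C.D q :=
  ((mfderiv (𝓡 n) (𝓡 r) C.π q).comp (C.D q).subtypeL).inverse

/-- The dual projection `i_D^* : T*Q → D*` (restriction of covectors). -/
def restr (β : Cotangent n Q) : C.DDual :=
  ⟨β.1, ContinuousLinearMap.comp β.2 (C.D β.1).subtypeL⟩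

/-- The dual inclusion `𝒫^* : D* → T*Q`. -/
def projDual (β : C.DDual) : Cotangent n Q :=
  ⟨β.1, β.2.comp (C.proj β.1)⟩

/-- The nonholonomic bracket `{φ, ψ}_{D*} = {φ ∘ i_D^*, ψ ∘ i_D^*}_{T*Q} ∘ 𝒫^*`. -/
def nhBracket (φ ψ : C.DDual → ℝ) (β : C.DDual) : ℝ :=
  poisson n (φ ∘ C.restr) (ψ ∘ C.restr) (C.projDual β)

/-- The Hamiltonian `h(β) = ½ ‖β‖² + U` on `T*Q`, where `‖β‖² = β(β^♯)` with `β^♯` the metric dual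
of `β`. -/
def hamiltonian (β : Cotangent n Q) : ℝ :=
  1 / 2 * β.2 ((C.metric.inner β.1).inverse β.2) + C.potential β.1

/-- The constrained Hamiltonian `h_c = h ∘ 𝒫^*` on `D*`. -/
def constrainedHamiltonian (β : C.DDual) : ℝ := C.hamiltonian (C.projDual β)

variable [IsManifold (𝓡 r) ∞ S]

/-- The orbit projection `D* → D*/G`, composed with the identification `D*/G ≅ T*S` given by
`[β] ↦ β ∘ hor_q`. -/
def reduce (β : C.DDual) : Cotangent r S := ⟨C.π β.1, β.2.comp (C.hor β.1)⟩

/-- `X` is the reduced vector field on `T*S`: a smooth vector field whose action on functions is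
`X[φ] ∘ Π = {φ ∘ Π, h_c}_{D*}`, where `Π = C.reduce : D* → D*/G ≅ T*S`. Equivalently, `X` is
`Π`-related to the vector field `X_nh = {·, h_c}_{D*}` that describes the nonholonomic dynamics. -/
structure IsReducedVectorField (X : (α : Cotangent r S) → TangentSpace (cotModel r) α) :
    Prop where
  smooth : ContMDiff (cotModel r) (cotModel r).tangent ∞
    (fun α => (⟨α, X α⟩ : TangentBundle (cotModel r) (Cotangent r S)))
  derivation : ∀ φ : Cotangent r S → ℝ, ContMDiff (cotModel r) 𝓘(ℝ, ℝ) ∞ φ → ∀ β : C.DDual,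
    mfderiv (cotModel r) 𝓘(ℝ, ℝ) φ (C.reduce β) (X (C.reduce β)) =
      C.nhBracket (φ ∘ C.reduce) C.constrainedHamiltonian β

/-- The reduced equations of motion preserve the volume form `μ` on `T*S`: the Lie derivative of
`μ` along the reduced vector field vanishes. -/
def PreservesVolume
    (μ : (α : Cotangent r S) → (TangentSpace (cotModel r) α) [⋀^(Fin r × Fin 2)]→ₗ[ℝ] ℝ) : Prop :=
  ∃ X : (α : Cotangent r S) → TangentSpace (cotModel r) α, C.IsReducedVectorField X ∧
    ∀ (α : Cotangent r S) (v : Fin r × Fin 2 → TangentSpace (cotModel r) α),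
      lieDerivForm (cotModel r) X μ α v = 0

end System

end Chaplygin

end

/-! An invariant `V` descends to a smooth `v` on `S` with `V = v ∘ π`. Adding `V` to the potential
adds `V ∘ τ` to `h_c ∘ i_D^*`, and the Hamiltonian vector of `V ∘ τ` is the vertical vector `-dV`
(`hamVec_add_comp_proj`). The reduction `Π ∘ i_D^*` is linear on fibres, `β ↦ β ∘ hor`, and `dV ∘
hor = dv ∘ Tπ ∘ hor = dv`. It therefore carries the vertical vector `-dV` to the vertical vector
`-dv` (`diffAt_comp_reduce_comp_restr`), and the reduced field `X` becomes `X + force v`.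

The Lie derivative is additive in the field, so it remains to see that `force v` preserves every
basic volume (`lieDerivForm_force_basicVolume`). In canonical coordinates the field is `(0,
-dv(q))`. The coefficient of the volume is constant along the fibres, so its derivative along the
field vanishes. The Jacobian of the field maps base directions to fibre directions and kills the
latter, so its trace, the divergence, vanishes too.

These computations with `mfderiv` need `h_c ∘ i_D^*` and `Π ∘ i_D^*` to be smooth on `T*Q`. Both are
written in a local frame of `D`, where they involve only smooth operator-valued maps and inverses of
invertible ones. -/

noncomputable section

namespace Chaplygin

open Bundle Filter Topology

/-! ### Canonical coordinates on `T*M`: symplectic form, Hamiltonian vectors, vertical directions.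
-/

section Cotangent

variable {m : ℕ} {M : Type*} [TopologicalSpace M] [ChartedSpace (Eu m) M] [IsManifold (𝓡 m) ∞ M]

/-- The derivative of the inverse of the preferred chart at `x` of `M`. -/
def symmDeriv (x : M) (q : Eu m) : Eu m →L[ℝ] Eu m :=
  mfderivWithin 𝓘(ℝ, Eu m) (𝓡 m) (extChartAt (𝓡 m) x).symm (range (𝓡 m)) q

theorem symmDeriv_self (x : M) :
    symmDeriv x (extChartAt (𝓡 m) x x) = ContinuousLinearMap.id ℝ (Eu m) :=
  mfderivWithin_range_extChartAt_symm

/-- The covector underlying a point of `T*M`, in the coordinates of the preferred chart at its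
base point. -/
def momentum (α : Cotangent m M) : Eu m →L[ℝ] ℝ := α.2

/-- The trivialization of the hom bundle precomposes with the inverse trivialization of the tangent
bundle, which is the derivative of the inverse chart; the trivial factor `ℝ` contributes the
identity. -/
theorem extChartAt_cotangent_apply (α β : Cotangent m M) (h : β.1 ∈ (chartAt (Eu m) α.1).source) :
    extChartAt (cotModel m) α β = (extChartAt (𝓡 m) α.1 β.1,
      (momentum β).comp (symmDeriv α.1 (extChartAt (𝓡 m) α.1 β.1))) := by
  rw [symmDeriv, ← TangentBundle.symmL_trivializationAt h]
  rw [FiberBundle.extChartAt]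
  simp only [mfld_simps]
  rw [hom_trivializationAt_apply]
  refine Prod.ext rfl ?_
  ext w
  exact congrArg (fun A : ℝ →L[ℝ] ℝ => A (β.2 ((trivializationAt (Eu m)
    (TangentSpace (𝓡 m)) α.proj).symmL ℝ β.proj w)))
    (Trivial.continuousLinearMapAt_trivialization ℝ M ℝ β.proj)

theorem extChartAt_cotangent_target (α : Cotangent m M) :
    (extChartAt (cotModel m) α).target = (extChartAt (𝓡 m) α.1).target ×ˢ univ := by
  rw [FiberBundle.extChartAt_target]
  congr 1
  rw [inter_eq_left, hom_trivializationAt_baseSet]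
  intro y hy
  have := (extChartAt (𝓡 m) α.1).map_target hy
  rw [extChartAt_source] at this
  exact ⟨this, trivial⟩

theorem extChartAt_cotangent_symm_fst (α : Cotangent m M) (y : Eu m × (Eu m →L[ℝ] ℝ)) :
    ((extChartAt (cotModel m) α).symm y).1 = (extChartAt (𝓡 m) α.1).symm y.1 := by
  rw [FiberBundle.extChartAt]
  rfl

theorem extChartAt_cotangent_symm_comp (α : Cotangent m M) {y : Eu m × (Eu m →L[ℝ] ℝ)}
    (hy : y ∈ (extChartAt (cotModel m) α).target) :
    (momentum ((extChartAt (cotModel m) α).symm y)).comp (symmDeriv α.1 y.1) = y.2 := by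
  have h1 := extChartAt_cotangent_symm_fst α y
  have hy' := hy
  rw [extChartAt_cotangent_target] at hy'
  have h2 := extChartAt_cotangent_apply α ((extChartAt (cotModel m) α).symm y) (by
    rw [h1, ← extChartAt_source (𝓡 m)]
    exact (extChartAt (𝓡 m) α.1).map_target hy'.1)
  rw [(extChartAt (cotModel m) α).right_inv hy] at h2
  have h3 := congrArg Prod.snd h2
  have h4 := congrArg Prod.fst h2
  simp only at h3 h4
  rw [← h4] at h3
  exact h3.symm

theorem mfderiv_proj_comp_extChartAt_symm (α : Cotangent m M) {y : Eu m × (Eu m →L[ℝ] ℝ)}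
    (hy : y ∈ (extChartAt (cotModel m) α).target) (w : Eu m × (Eu m →L[ℝ] ℝ)) :
    mfderiv (cotModel m) (𝓡 m) (fun a : Cotangent m M => a.1)
      ((extChartAt (cotModel m) α).symm y)
      (mfderivWithin 𝓘(ℝ, Eu m × (Eu m →L[ℝ] ℝ)) (cotModel m) (extChartAt (cotModel m) α).symm
        (range (cotModel m)) y w) =
      symmDeriv α.1 y.1 w.1 := by
  have hy' := hy
  rw [extChartAt_cotangent_target] at hy'
  have hr : range (cotModel m) = univ := (cotModel m).range_eq_univ
  have hr' : range (𝓡 m) = univ := (𝓡 m).range_eq_univ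
  have A := mdifferentiableWithinAt_extChartAt_symm hy
  have B := mdifferentiableWithinAt_extChartAt_symm hy'.1
  rw [hr, mdifferentiableWithinAt_univ] at A
  rw [hr', mdifferentiableWithinAt_univ] at B
  rw [symmDeriv, hr, hr', mfderivWithin_univ, mfderivWithin_univ]
  have P : MDifferentiableAt (cotModel m) (𝓡 m) (fun a : Cotangent m M => a.1)
      ((extChartAt (cotModel m) α).symm y) := mdifferentiableAt_proj _
  have h1 := mfderiv_comp_apply y P A w
  rw [← h1]
  have h2 : (fun a : Cotangent m M => a.1) ∘ (extChartAt (cotModel m) α).symm =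
      (extChartAt (𝓡 m) α.1).symm ∘ Prod.fst := funext (extChartAt_cotangent_symm_fst α)
  rw [h2]
  have h3 : MDifferentiableAt 𝓘(ℝ, Eu m × (Eu m →L[ℝ] ℝ)) 𝓘(ℝ, Eu m)
    (Prod.fst : Eu m × (Eu m →L[ℝ] ℝ) → Eu m) y := differentiableAt_fst.mdifferentiableAt
  refine (mfderiv_comp_apply y B h3 w).trans ?_
  rw [mfderiv_eq_fderiv, fderiv_fst]
  rfl

theorem _root_.DifferentiableAt.ofSubsingleton {E F G : Type*} [NormedAddCommGroup E]
    [NormedSpace ℝ E] [NormedAddCommGroup F] [NormedSpace ℝ F] [NormedAddCommGroup G]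
    [NormedSpace ℝ G] {L : G → E →L[ℝ] F} {x : G} (hL : DifferentiableAt ℝ L x) :
    DifferentiableAt ℝ (fun y => ContinuousAlternatingMap.ofSubsingleton ℝ E F (0 : Fin 1) (L y))
      x :=
  (ContinuousAlternatingMap.ofSubsingletonLIE (𝕜 := ℝ) (E := E) (F := F)
    (0 : Fin 1)).differentiable.differentiableAt.comp x hL

/-- In the chart at `α`, the Liouville form is `(q, p) ↦ p ∘ fst`. -/
theorem liouvilleForm_extChartAt_symm (α : Cotangent m M) {y : Eu m × (Eu m →L[ℝ] ℝ)}
    (hy : y ∈ (extChartAt (cotModel m) α).target) :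
    (liouvilleForm m ((extChartAt (cotModel m) α).symm y)).compContinuousLinearMap
      (mfderivWithin 𝓘(ℝ, Eu m × (Eu m →L[ℝ] ℝ)) (cotModel m) (extChartAt (cotModel m) α).symm
        (range (cotModel m)) y) =
    ContinuousAlternatingMap.ofSubsingleton ℝ (Eu m × (Eu m →L[ℝ] ℝ)) ℝ (0 : Fin 1)
      (y.2.comp (ContinuousLinearMap.fst ℝ (Eu m) (Eu m →L[ℝ] ℝ))) := by
  ext w
  refine (congrArg ((extChartAt (cotModel m) α).symm y).2
    (mfderiv_proj_comp_extChartAt_symm α hy (w 0))).trans ?_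
  exact congrArg (fun A : Eu m →L[ℝ] ℝ => A (w 0).1) (extChartAt_cotangent_symm_comp α hy)

/-- The canonical symplectic form in the coordinates of the preferred chart. -/
theorem omegaCan_apply (α : Cotangent m M) (u v : Eu m × (Eu m →L[ℝ] ℝ)) :
    omegaCan m α ![u, v] = v.2 u.1 - u.2 v.1 := by
  have hr : range (cotModel m) = univ := (cotModel m).range_eq_univ
  have hev : (fun y => (liouvilleForm m ((extChartAt (cotModel m) α).symm y)).compContinuousLinearMap
      (mfderivWithin 𝓘(ℝ, Eu m × (Eu m →L[ℝ] ℝ)) (cotModel m) (extChartAt (cotModel m) α).symm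
        (range (cotModel m)) y)) =ᶠ[𝓝 (extChartAt (cotModel m) α α)]
      fun y : Eu m × (Eu m →L[ℝ] ℝ) =>
        ContinuousAlternatingMap.ofSubsingleton ℝ (Eu m × (Eu m →L[ℝ] ℝ)) ℝ (0 : Fin 1)
      (y.2.comp (ContinuousLinearMap.fst ℝ (Eu m) (Eu m →L[ℝ] ℝ))) := by
    filter_upwards [extChartAt_target_mem_nhds α] with y hy
    exact liouvilleForm_extChartAt_symm α hy
  unfold omegaCan extDerivForm
  rw [mfderiv_extChartAt_self, hr, extDerivWithin_univ]
  rw [hr] at hev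
  rw [hev.extDeriv_eq]
  have hd : ∀ w : Eu m × (Eu m →L[ℝ] ℝ), HasFDerivAt
      (fun y : Eu m × (Eu m →L[ℝ] ℝ) => y.2 w.1)
      ((ContinuousLinearMap.apply ℝ ℝ w.1).comp (ContinuousLinearMap.snd ℝ (Eu m) (Eu m →L[ℝ] ℝ)))
      (extChartAt (cotModel m) α α) := fun w =>
    ((ContinuousLinearMap.apply ℝ ℝ w.1).comp
      (ContinuousLinearMap.snd ℝ (Eu m) (Eu m →L[ℝ] ℝ))).hasFDerivAt
  have hdiff : DifferentiableAt ℝ (fun y : Eu m × (Eu m →L[ℝ] ℝ) =>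
      ContinuousAlternatingMap.ofSubsingleton ℝ (Eu m × (Eu m →L[ℝ] ℝ)) ℝ (0 : Fin 1)
        (y.2.comp (ContinuousLinearMap.fst ℝ (Eu m) (Eu m →L[ℝ] ℝ))))
      (extChartAt (cotModel m) α α) := by
    apply DifferentiableAt.ofSubsingleton
    fun_prop
  have key : extDeriv (fun y : Eu m × (Eu m →L[ℝ] ℝ) =>
      ContinuousAlternatingMap.ofSubsingleton ℝ (Eu m × (Eu m →L[ℝ] ℝ)) ℝ (0 : Fin 1)
        (y.2.comp (ContinuousLinearMap.fst ℝ (Eu m) (Eu m →L[ℝ] ℝ))))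
      (extChartAt (cotModel m) α α) ![u, v] = u.2 v.1 - v.2 u.1 := by
    rw [extDeriv_apply hdiff, Fin.sum_univ_two]
    have e0 : Fin.removeNth 0 ![u, v] 0 = v := rfl
    have e1 : Fin.removeNth 1 ![u, v] 0 = u := rfl
    simp only [ContinuousAlternatingMap.ofSubsingleton_apply_apply, e0, e1,
      ContinuousLinearMap.comp_apply, ContinuousLinearMap.coe_fst', (hd _).fderiv]
    simp
    ring
  exact (congrArg Neg.neg key).trans (neg_sub _ _)

theorem exists_omegaCan_eq (α : Cotangent m M) (l : (Eu m × (Eu m →L[ℝ] ℝ)) →L[ℝ] ℝ) :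
    ∃ u : Eu m × (Eu m →L[ℝ] ℝ), ∀ v : Eu m × (Eu m →L[ℝ] ℝ), omegaCan m α ![u, v] = l v := by
  -- By `omegaCan_apply` the equation is `v.2 u.1 - u.2 v.1 = l v`. The covector `u.2` is minus `l`
  -- on base directions; `u.1` has to represent `l` on covectors, and exists by reflexivity in
  -- finite dimension.
  let l₂ : Module.Dual ℝ (Eu m →L[ℝ] ℝ) :=
    (l.comp (ContinuousLinearMap.inr ℝ (Eu m) (Eu m →L[ℝ] ℝ))).toLinearMap
  let l₃ : Module.Dual ℝ (Module.Dual ℝ (Eu m)) := l₂ ∘ₗ LinearMap.toContinuousLinearMap.toLinearMap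
  obtain ⟨a, ha⟩ := (Module.bijective_dual_eval ℝ (Eu m)).2 l₃
  refine ⟨(a, -l.comp (ContinuousLinearMap.inl ℝ (Eu m) (Eu m →L[ℝ] ℝ))), fun v => ?_⟩
  rw [omegaCan_apply]
  have h : v.2 a = l (0, v.2) := by
    have := congrArg (fun k => k v.2.toLinearMap) ha
    exact this
  have h2 : l v = l (v.1, 0) + l (0, v.2) := by rw [← map_add]; simp
  rw [h, h2]
  simp [add_comm]

/-- Uniqueness in the nondegeneracy of the symplectic form: it pins down the vector chosen by
`Classical.epsilon` in `hamVec`. -/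
theorem omegaCan_left_injective (α : Cotangent m M) {u u' : Eu m × (Eu m →L[ℝ] ℝ)}
    (h : ∀ v : Eu m × (Eu m →L[ℝ] ℝ), omegaCan m α ![u, v] = omegaCan m α ![u', v]) : u = u' := by
  simp only [omegaCan_apply] at h
  refine Prod.ext ?_ ?_
  · refine (Module.bijective_dual_eval ℝ (Eu m)).1 (LinearMap.ext fun k => ?_)
    simpa using h (0, LinearMap.toContinuousLinearMap k)
  · ext w
    simpa using h (w, 0)

/-- The differential of a function on `T*M`, in the coordinates of the preferred chart. -/
def diffAt (φ : Cotangent m M → ℝ) (α : Cotangent m M) : (Eu m × (Eu m →L[ℝ] ℝ)) →L[ℝ] ℝ :=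
  mfderiv (cotModel m) 𝓘(ℝ, ℝ) φ α

/-- The differential of a function on `M`, as a covector in the coordinates of the preferred
chart. -/
def covec (V : M → ℝ) (x : M) : Eu m →L[ℝ] ℝ := mfderiv (𝓡 m) 𝓘(ℝ, ℝ) V x

theorem hamVec_spec (φ : Cotangent m M → ℝ) (α : Cotangent m M) (v : Eu m × (Eu m →L[ℝ] ℝ)) :
    omegaCan m α ![hamVec m φ α, v] = diffAt φ α v :=
  Classical.epsilon_spec (p := fun X : TangentSpace (cotModel m) α =>
    ∀ V : TangentSpace (cotModel m) α,
      omegaCan m α ![X, V] = mfderiv (cotModel m) 𝓘(ℝ, ℝ) φ α V)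
    (exists_omegaCan_eq α (diffAt φ α)) v

theorem hamVec_eq_iff {φ : Cotangent m M → ℝ} {α : Cotangent m M} {X : Eu m × (Eu m →L[ℝ] ℝ)} :
    hamVec m φ α = X ↔ ∀ v : Eu m × (Eu m →L[ℝ] ℝ), v.2 X.1 - X.2 v.1 = diffAt φ α v := by
  constructor
  · rintro rfl v
    exact (omegaCan_apply α (hamVec m φ α) v).symm.trans (hamVec_spec φ α v)
  · intro h
    refine omegaCan_left_injective α fun v => ?_
    exact (hamVec_spec φ α v).trans ((h v).symm.trans (omegaCan_apply α X v).symm)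

theorem poisson_eq_diffAt (φ ψ : Cotangent m M → ℝ) (α : Cotangent m M) :
    poisson m φ ψ α = diffAt φ α (hamVec m ψ α) :=
  hamVec_spec φ α _

/-- The vertical tangent vector at `α` given by the covector `ε`. -/
def vertical (α : Cotangent m M) (ε : Eu m →L[ℝ] ℝ) : TangentSpace (cotModel m) α :=
  ((0, ε) : Eu m × (Eu m →L[ℝ] ℝ))

theorem mfderiv_proj_apply (α : Cotangent m M) (v : Eu m × (Eu m →L[ℝ] ℝ)) :
    mfderiv (cotModel m) (𝓡 m) (fun a : Cotangent m M => a.1) α v = v.1 := by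
  have h := mfderiv_proj_comp_extChartAt_symm α (mem_extChartAt_target α) v
  rw [mfderivWithin_range_extChartAt_symm, extChartAt_to_inv] at h
  refine h.trans ?_
  rw [extChartAt_cotangent_apply α α (mem_chart_source _ _)]
  exact congrArg (fun A : Eu m →L[ℝ] Eu m => A v.1) (symmDeriv_self α.1)

theorem diffAt_add_comp_proj {φ : Cotangent m M → ℝ} {V : M → ℝ} {α : Cotangent m M}
    (hφ : MDifferentiableAt (cotModel m) 𝓘(ℝ, ℝ) φ α)
    (hV : MDifferentiableAt (𝓡 m) 𝓘(ℝ, ℝ) V α.1) (v : Eu m × (Eu m →L[ℝ] ℝ)) :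
    diffAt (fun a => φ a + V a.1) α v = diffAt φ α v + covec V α.1 v.1 := by
  have P : MDifferentiableAt (cotModel m) (𝓡 m) (fun a : Cotangent m M => a.1) α :=
    mdifferentiableAt_proj _
  have h1 : diffAt (fun a : Cotangent m M => V a.1) α v = covec V α.1 v.1 :=
    (mfderiv_comp_apply α hV P v).trans (congrArg (covec V α.1) (mfderiv_proj_apply α v))
  rw [← h1, ← add_apply]
  exact congrArg (fun A : (Eu m × (Eu m →L[ℝ] ℝ)) →L[ℝ] ℝ => A v) (mfderiv_add hφ (hV.comp α P))

/-- The differential of `V ∘ τ` annihilates vertical vectors, so its Hamiltonian vector has no base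
component; the sign comes from `Ω_can = dq ∧ dp`. -/
theorem hamVec_add_comp_proj {φ : Cotangent m M → ℝ} {V : M → ℝ} {α : Cotangent m M}
    (hφ : MDifferentiableAt (cotModel m) 𝓘(ℝ, ℝ) φ α)
    (hV : MDifferentiableAt (𝓡 m) 𝓘(ℝ, ℝ) V α.1) :
    hamVec m (fun a => φ a + V a.1) α = hamVec m φ α + vertical α (-covec V α.1) := by
  refine hamVec_eq_iff.2 fun v => ?_
  rw [diffAt_add_comp_proj hφ hV, ← hamVec_eq_iff (φ := φ) (α := α).1 rfl v]
  change v.2 (_ + 0) - (_ + -covec V α.1) v.1 = _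
  rw [add_zero, add_apply, neg_apply]
  ring

theorem poisson_add_comp_proj {F φ : Cotangent m M → ℝ} {V : M → ℝ} {α : Cotangent m M}
    (hφ : MDifferentiableAt (cotModel m) 𝓘(ℝ, ℝ) φ α)
    (hV : MDifferentiableAt (𝓡 m) 𝓘(ℝ, ℝ) V α.1) :
    poisson m F (fun a => φ a + V a.1) α = poisson m F φ α +
      diffAt F α (vertical α (-covec V α.1)) := by
  rw [poisson_eq_diffAt, poisson_eq_diffAt, hamVec_add_comp_proj hφ hV]
  exact map_add (diffAt F α) _ _

/-- The curve `t ↦ α + t ε` in a fibre of the cotangent bundle. -/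
def fibreLine (α : Cotangent m M) (ε : Eu m →L[ℝ] ℝ) (t : ℝ) : Cotangent m M :=
  ⟨α.1, (momentum α + t • ε : Eu m →L[ℝ] ℝ)⟩

omit [IsManifold (𝓡 m) ∞ M] in
theorem fibreLine_zero (α : Cotangent m M) (ε : Eu m →L[ℝ] ℝ) : fibreLine α ε 0 = α := by
  have h : momentum α + (0 : ℝ) • ε = momentum α := by simp
  unfold fibreLine
  rw [h]
  rfl

theorem extChartAt_fibreLine (α β : Cotangent m M) (ε : Eu m →L[ℝ] ℝ)
    (h : β.1 ∈ (chartAt (Eu m) α.1).source) (t : ℝ) :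
    extChartAt (cotModel m) α (fibreLine β ε t) = extChartAt (cotModel m) α β +
      t • ((0, ε.comp (symmDeriv α.1 (extChartAt (𝓡 m) α.1 β.1))) :
        Eu m × (Eu m →L[ℝ] ℝ)) := by
  rw [extChartAt_cotangent_apply α β h, extChartAt_cotangent_apply α (fibreLine β ε t) h]
  refine Prod.ext ?_ ?_
  · simp [fibreLine]
  · ext w
    simp only [fibreLine, momentum, Prod.snd_add, Prod.smul_snd]
    rfl

/-- In the preferred chart at `α` the curve is affine with velocity `(0, ε)`, because `symmDeriv` is
the identity at the centre of the chart. -/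
theorem hasMFDerivAt_fibreLine (α : Cotangent m M) (ε : Eu m →L[ℝ] ℝ) :
    HasMFDerivAt 𝓘(ℝ, ℝ) (cotModel m) (fibreLine α ε) 0
      (ContinuousLinearMap.toSpanSingleton ℝ
        (show TangentSpace (cotModel m) (fibreLine α ε 0) from vertical α ε)) := by
  have hw : writtenInExtChartAt 𝓘(ℝ, ℝ) (cotModel m) 0 (fibreLine α ε) =
      fun t => extChartAt (cotModel m) α α + t • ((0, ε) : Eu m × (Eu m →L[ℝ] ℝ)) := by
    ext1 t
    simp only [writtenInExtChartAt, mfld_simps]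
    have := extChartAt_fibreLine α α ε (mem_chart_source _ _) t
    rw [symmDeriv_self] at this
    rw [fibreLine_zero]
    exact this
  have hd : HasFDerivAt
      (fun t : ℝ => extChartAt (cotModel m) α α + t • ((0, ε) : Eu m × (Eu m →L[ℝ] ℝ)))
      (ContinuousLinearMap.toSpanSingleton ℝ ((0, ε) : Eu m × (Eu m →L[ℝ] ℝ))) 0 :=
    ((ContinuousLinearMap.toSpanSingleton ℝ
      ((0, ε) : Eu m × (Eu m →L[ℝ] ℝ))).hasFDerivAt).const_add _
  constructor
  · rw [continuousAt_hom_bundle]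
    refine ⟨continuousAt_const, ?_⟩
    refine (hd.continuousAt.snd).congr (Eventually.of_forall fun t => ?_)
    have := extChartAt_fibreLine α α ε (mem_chart_source _ _) t
    rw [symmDeriv_self] at this
    refine (congrArg Prod.snd this).symm.trans ?_
    rw [FiberBundle.extChartAt]
    rfl
  · rw [hw]
    simp only [mfld_simps]
    exact hd.hasFDerivWithinAt

/-- Turns vertical differentials into one-variable derivatives, so that two of them can be compared
by uniqueness of derivatives. -/
theorem hasDerivAt_comp_fibreLine {N : Type*} [NormedAddCommGroup N] [NormedSpace ℝ N]
    {F : Cotangent m M → N} {α : Cotangent m M}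
    (hF : MDifferentiableAt (cotModel m) 𝓘(ℝ, N) F α) (ε : Eu m →L[ℝ] ℝ) :
    HasDerivAt (fun t => F (fibreLine α ε t))
      (mfderiv (cotModel m) 𝓘(ℝ, N) F α (vertical α ε)) 0 := by
  have hc := hasMFDerivAt_fibreLine α ε
  have hF' : HasMFDerivAt (cotModel m) 𝓘(ℝ, N) F (fibreLine α ε 0)
      (mfderiv (cotModel m) 𝓘(ℝ, N) F (fibreLine α ε 0)) := by
    rw [fibreLine_zero]
    exact hF.hasMFDerivAt
  let A : (Eu m × (Eu m →L[ℝ] ℝ)) →L[ℝ] N := mfderiv (cotModel m) 𝓘(ℝ, N) F α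
  let B : ℝ →L[ℝ] Eu m × (Eu m →L[ℝ] ℝ) := ContinuousLinearMap.toSpanSingleton ℝ
    ((0, ε) : Eu m × (Eu m →L[ℝ] ℝ))
  have h : HasFDerivAt (fun t => F (fibreLine α ε t)) (A.comp B) 0 := by
    have := (hF'.comp 0 hc).hasFDerivAt
    rw [fibreLine_zero] at this
    exact this
  refine h.hasDerivAt.congr_deriv ?_
  exact congrArg A (one_smul ℝ ((0, ε) : Eu m × (Eu m →L[ℝ] ℝ)))

theorem mfderiv_extChartAt_vertical (α β : Cotangent m M) (ε : Eu m →L[ℝ] ℝ)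
    (h : β.1 ∈ (chartAt (Eu m) α.1).source) :
    mfderiv (cotModel m) 𝓘(ℝ, Eu m × (Eu m →L[ℝ] ℝ)) (extChartAt (cotModel m) α) β (vertical β ε) =
     ((0, ε.comp (symmDeriv α.1 (extChartAt (𝓡 m) α.1 β.1))) : Eu m × (Eu m →L[ℝ] ℝ)) := by
  have hF : MDifferentiableAt (cotModel m) 𝓘(ℝ, Eu m × (Eu m →L[ℝ] ℝ))
      (extChartAt (cotModel m) α) β := by
    refine mdifferentiableAt_extChartAt ?_
    rw [FiberBundle.chartedSpace_chartAt]
    simp only [mfld_simps]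
    exact ⟨⟨h, trivial⟩, h⟩
  refine (hasDerivAt_comp_fibreLine hF ε).unique ?_
  simp only [extChartAt_fibreLine α β ε h]
  have := ((hasDerivAt_id (0 : ℝ)).smul_const ((0, ε.comp (symmDeriv α.1
    (extChartAt (𝓡 m) α.1 β.1))) : Eu m × (Eu m →L[ℝ] ℝ))).const_add
      (extChartAt (cotModel m) α β)
  rwa [one_smul] at this

end Cotangent

/-! ### Additivity of the Lie derivative, and the trace formula for top-degree forms. -/

section Forms

variable {E H M : Type*} [NormedAddCommGroup E] [NormedSpace ℝ E] [TopologicalSpace H]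
  {I : ModelWithCorners ℝ E H} [TopologicalSpace M] [ChartedSpace H M]

/-- The local expression of a differential form in the preferred chart at `x`. -/
def chartForm {ι : Type*} (η : (x : M) → (TangentSpace I x) [⋀^ι]→ₗ[ℝ] ℝ) (x : M) (y : E) :
    E [⋀^ι]→ₗ[ℝ] ℝ :=
  (η ((extChartAt I x).symm y)).compLinearMap
    (mfderivWithin 𝓘(ℝ, E) I (extChartAt I x).symm (range I) y).toLinearMap

theorem chartForm_self [IsManifold I 1 M] {ι : Type*}
    (η : (x : M) → (TangentSpace I x) [⋀^ι]→ₗ[ℝ] ℝ) (x : M) (w : ι → E) :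
    chartForm η x (extChartAt I x x) w = η x w := by
  unfold chartForm
  rw [mfderivWithin_range_extChartAt_symm, extChartAt_to_inv]
  rfl

/-- The local expression of a vector field in the preferred chart at `x`. -/
def chartField (X : (x : M) → TangentSpace I x) (x : M) : E → E :=
  VectorField.mpullbackWithin 𝓘(ℝ, E) I (extChartAt I x).symm X (range I)

theorem chartField_add (X Y : (x : M) → TangentSpace I x) (x : M) :
    chartField (X + Y) x = chartField X x + chartField Y x :=
  VectorField.mpullbackWithin_add

/-- The local expression of a family of tangent vectors at `x` in the preferred chart. -/
def chartVec {ι : Type*} (x : M) (v : ι → TangentSpace I x) (i : ι) : E :=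
  mfderiv I 𝓘(ℝ, E) (extChartAt I x) x (v i)

theorem lieDerivForm_eq {ι : Type*} [Fintype ι] [DecidableEq ι] (X : (x : M) → TangentSpace I x)
    (η : (x : M) → (TangentSpace I x) [⋀^ι]→ₗ[ℝ] ℝ) (x : M) (v : ι → TangentSpace I x) :
    lieDerivForm I X η x v =
      fderivWithin ℝ (fun y => chartForm η x y (chartVec x v)) (range I) (extChartAt I x x)
        (chartField X x (extChartAt I x x)) +
      ∑ i, chartForm η x (extChartAt I x x) (Function.update (chartVec x v) i
        (fderivWithin ℝ (chartField X x) (range I) (extChartAt I x x) (chartVec x v i))) :=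
  rfl

theorem lieDerivForm_add {ι : Type*} [Fintype ι] [DecidableEq ι] {X Y : (x : M) → TangentSpace I x}
    (η : (x : M) → (TangentSpace I x) [⋀^ι]→ₗ[ℝ] ℝ) {x : M}
    (hX : DifferentiableWithinAt ℝ (chartField X x) (range I) (extChartAt I x x))
    (hY : DifferentiableWithinAt ℝ (chartField Y x) (range I) (extChartAt I x x))
    (v : ι → TangentSpace I x) :
    lieDerivForm I (X + Y) η x v = lieDerivForm I X η x v + lieDerivForm I Y η x v := by
  have hu : UniqueDiffWithinAt ℝ (range I) (extChartAt I x x) :=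
    I.uniqueDiffOn _ (mem_range_self _)
  simp only [lieDerivForm_eq, chartField_add, fderivWithin_add hu hX hY, Pi.add_apply, map_add,
    add_apply, AlternatingMap.map_update_add, Finset.sum_add_distrib]
  ring

/-- A top-degree form is a multiple of the determinant. With `W` the matrix of `w`, replacing its
column `i` by `A w_i` gives, by Cramer's rule, the entry `(adj W · A · W) i i`. Summing and
permuting cyclically, `tr (A · W · adj W) = tr A · det W`; no independence of `w` is needed. -/
theorem _root_.AlternatingMap.sum_update_eq_trace_smul {V ι : Type*} [AddCommGroup V] [Module ℝ V]
    [Fintype ι] [DecidableEq ι] (b : Module.Basis ι ℝ V) (η : V [⋀^ι]→ₗ[ℝ] ℝ)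
    (A : V →ₗ[ℝ] V) (w : ι → V) :
    ∑ i, η (Function.update w i (A (w i))) = LinearMap.trace ℝ V A * η w := by
  rw [η.eq_smul_basis_det b]
  simp only [AlternatingMap.smul_apply, Module.Basis.det_apply, Module.Basis.toMatrix_update,
    smul_eq_mul, ← Finset.mul_sum]
  have h : ∀ i, ((b.toMatrix w).updateCol i (b.repr (A (w i)))).det =
      ((b.toMatrix w).adjugate * (LinearMap.toMatrix b b A * b.toMatrix w)) i i := by
    intro i
    rw [← Matrix.cramer_apply, Matrix.cramer_eq_adjugate_mulVec, ← LinearMap.toMatrix_mulVec_repr b b]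
    rfl
  simp only [h]
  change η b * Matrix.trace _ = _
  rw [Matrix.trace_mul_comm, Matrix.mul_assoc, Matrix.mul_adjugate, LinearMap.trace_eq_matrix_trace ℝ b]
  simp
  ring

end Forms

/-! ### The field `force v` and its Lie derivative on basic volumes. -/

section Cotangent
variable {m : ℕ} {M : Type*} [TopologicalSpace M] [ChartedSpace (Eu m) M] [IsManifold (𝓡 m) ∞ M]

theorem chartField_vertical (α : Cotangent m M) (ε : M → (Eu m →L[ℝ] ℝ))
    {y : Eu m × (Eu m →L[ℝ] ℝ)} (hy : y ∈ (extChartAt (cotModel m) α).target) :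
    chartField (fun β : Cotangent m M => vertical β (ε β.1)) α y =
      (0, (ε ((extChartAt (𝓡 m) α.1).symm y.1)).comp (symmDeriv α.1 y.1)) := by
  have hi := isInvertible_mfderivWithin_extChartAt_symm hy
  have hs := (extChartAt (cotModel m) α).map_target hy
  have h1 := extChartAt_cotangent_symm_fst α y
  have hsrc : ((extChartAt (cotModel m) α).symm y).1 ∈ (chartAt (Eu m) α.1).source := by
    rw [h1, ← extChartAt_source (𝓡 m)]
    rw [extChartAt_cotangent_target] at hy
    exact (extChartAt (𝓡 m) α.1).map_target hy.1
  have h2 := mfderiv_extChartAt_vertical α ((extChartAt (cotModel m) α).symm y)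
    (ε ((extChartAt (cotModel m) α).symm y).1) hsrc
  have h3 := mfderivWithin_extChartAt_symm_comp_mfderiv_extChartAt hy
  have h4 : extChartAt (𝓡 m) α.1 ((extChartAt (𝓡 m) α.1).symm y.1) = y.1 := by
    rw [extChartAt_cotangent_target] at hy
    exact (extChartAt (𝓡 m) α.1).right_inv hy.1
  rw [h1, h4] at h2
  rw [← h2]
  -- The pullback of a field applies the inverse of the derivative of the inverse chart, so it
  -- suffices to push the coordinate vector forward and recover the vertical vector.
  refine hi.inverse_apply_eq.2 ?_
  exact (congrArg (fun e => vertical ((extChartAt (cotModel m) α).symm y) (ε e)) h1).trans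
    (congrArg (fun A => A (vertical ((extChartAt (cotModel m) α).symm y)
      (ε ((extChartAt (𝓡 m) α.1).symm y.1)))) h3).symm

theorem covec_comp_symmDeriv {v : M → ℝ} (hv : MDifferentiable (𝓡 m) 𝓘(ℝ, ℝ) v) (x : M) {q : Eu m}
    (hq : q ∈ (extChartAt (𝓡 m) x).target) :
    (covec v ((extChartAt (𝓡 m) x).symm q)).comp (symmDeriv x q) =
      fderiv ℝ (v ∘ (extChartAt (𝓡 m) x).symm) q := by
  have hr' : range (𝓡 m) = univ := (𝓡 m).range_eq_univ
  have B := mdifferentiableWithinAt_extChartAt_symm hq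
  rw [hr', mdifferentiableWithinAt_univ] at B
  rw [symmDeriv, hr', mfderivWithin_univ, ← mfderiv_eq_fderiv]
  exact (mfderiv_comp q (hv _) B).symm

/-- The vertical vector field `-dv` on `T*M`. -/
def force (v : M → ℝ) (α : Cotangent m M) : TangentSpace (cotModel m) α :=
  vertical α (-covec v α.1)

theorem chartField_force {v : M → ℝ} (hv : ContMDiff (𝓡 m) 𝓘(ℝ, ℝ) ∞ v) (α : Cotangent m M)
    {y : Eu m × (Eu m →L[ℝ] ℝ)} (hy : y ∈ (extChartAt (cotModel m) α).target) :
    chartField (force v) α y = (0, -fderiv ℝ (v ∘ (extChartAt (𝓡 m) α.1).symm) y.1) := by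
  refine (chartField_vertical α (fun x => -covec v x) hy).trans ?_
  rw [ContinuousLinearMap.neg_comp, covec_comp_symmDeriv (hv.mdifferentiable (by simp))]
  rw [extChartAt_cotangent_target] at hy
  exact hy.1

theorem contDiffAt_fderiv_chart {v : M → ℝ} (hv : ContMDiff (𝓡 m) 𝓘(ℝ, ℝ) ∞ v)
    (α : Cotangent m M) :
    ContDiffAt ℝ ∞ (fun q : Eu m => fderiv ℝ (v ∘ (extChartAt (𝓡 m) α.1).symm) q)
      (extChartAt (𝓡 m) α.1 α.1) := by
  have h : ContMDiffOn 𝓘(ℝ, Eu m) 𝓘(ℝ, ℝ) ∞ (v ∘ (extChartAt (𝓡 m) α.1).symm)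
      (extChartAt (𝓡 m) α.1).target :=
    hv.comp_contMDiffOn (contMDiffOn_extChartAt_symm α.1)
  have h' : ContDiffAt ℝ ∞ (v ∘ (extChartAt (𝓡 m) α.1).symm) (extChartAt (𝓡 m) α.1 α.1) :=
    h.contDiffOn.contDiffAt (extChartAt_target_mem_nhds _)
  exact h'.fderiv_right (by simp)

theorem chartField_force_eventuallyEq {v : M → ℝ} (hv : ContMDiff (𝓡 m) 𝓘(ℝ, ℝ) ∞ v)
    (α : Cotangent m M) :
    chartField (force v) α =ᶠ[𝓝 (extChartAt (cotModel m) α α)] fun y =>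
      (0, -fderiv ℝ (v ∘ (extChartAt (𝓡 m) α.1).symm) y.1) := by
  filter_upwards [extChartAt_target_mem_nhds α] with y hy
  exact chartField_force hv α hy

/-- Near `α` the field is the pullback under the chart of its coordinate expression, which is smooth
because `v` is. -/
theorem contMDiff_force {v : M → ℝ} (hv : ContMDiff (𝓡 m) 𝓘(ℝ, ℝ) ∞ v) :
    ContMDiff (cotModel m) (cotModel m).tangent ∞
      (fun α => (⟨α, force v α⟩ : TangentBundle (cotModel m) (Cotangent m M))) := by
  intro α
  have h1 : ContDiffAt ℝ ∞ (chartField (force v) α) (extChartAt (cotModel m) α α) := by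
    refine ContDiffAt.congr_of_eventuallyEq ?_ (chartField_force_eventuallyEq hv α)
    refine contDiffAt_const.prodMk (ContDiffAt.neg ?_)
    refine ContDiffAt.comp _ ?_ contDiffAt_fst
    rw [extChartAt_cotangent_apply α α (mem_chart_source _ _)]
    exact contDiffAt_fderiv_chart hv α
  have h2 := contMDiffAt_vectorSpace_iff_contDiffAt.2 h1
  have h3 := ContMDiffAt.mpullback_vectorField_preimage (x₀ := α) (f := extChartAt (cotModel m) α)
    (n := ∞) h2 contMDiffAt_extChartAt
    (isInvertible_mfderiv_extChartAt (mem_extChartAt_source α)) (by simp)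
  refine h3.congr_of_eventuallyEq ?_
  have h4 := VectorField.eventuallyEq_mpullback_mpullbackWithin_extChartAt (I := cotModel m)
    (s := univ) (x := α) (force v)
  rw [nhdsWithin_univ] at h4
  filter_upwards [h4] with β hβ
  rw [hβ]
  rfl

theorem fderiv_apply_eq_zero_of_const_line {W : Type*} [NormedAddCommGroup W] [NormedSpace ℝ W]
    {g : W → ℝ} {x z : W} (h : ∀ t : ℝ, g (x + t • z) = g x) : fderiv ℝ g x z = 0 := by
  by_cases hg : DifferentiableAt ℝ g x
  · have h1 : HasDerivAt (fun t : ℝ => g (x + t • z)) (fderiv ℝ g x z) 0 :=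
      hg.hasFDerivAt.hasLineDerivAt z
    simp only [h] at h1
    exact h1.unique (hasDerivAt_const _ _)
  -- Here `fderiv` has its default value `0`, so differentiability of the chart expression of a form
  -- never has to be proved.
  · rw [fderiv_zero_of_not_differentiableAt hg]
    rfl

/-- The formula of `omegaCan_apply` does not mention the point: in preferred coordinates `Ω_can` is
one constant form, and the density sees only the base point. -/
theorem basicVolume_eq_of_fst_eq (f : M → ℝ) {α β : Cotangent m M} (h : α.1 = β.1)
    (w : Fin m × Fin 2 → Eu m × (Eu m →L[ℝ] ℝ)) :
    basicVolume m f α w = basicVolume m f β w := by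
  have hω : @Eq ((Eu m × (Eu m →L[ℝ] ℝ)) [⋀^Fin 2]→ₗ[ℝ] ℝ) (omegaCan m α).toAlternatingMap
      (omegaCan m β).toAlternatingMap := by
    ext u
    have hu : u = ![u 0, u 1] := by ext i; fin_cases i <;> rfl
    rw [hu]
    exact (omegaCan_apply α (u 0) (u 1)).trans (omegaCan_apply β (u 0) (u 1)).symm
  have h2 := congrArg (fun η => wedgePow η m w) hω
  exact congrArg₂ (fun a b : ℝ => a * b) (congrArg f h) h2

theorem chartForm_basicVolume_add_smul (f : M → ℝ) (α : Cotangent m M) (ε : Eu m →L[ℝ] ℝ) (t : ℝ)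
    (w : Fin m × Fin 2 → Eu m × (Eu m →L[ℝ] ℝ)) :
    chartForm (basicVolume m f) α (extChartAt (cotModel m) α α + t • (0, ε)) w =
      basicVolume m f α w := by
  have hx := extChartAt_fibreLine α α ε (mem_chart_source _ _) t
  rw [symmDeriv_self, ContinuousLinearMap.comp_id] at hx
  rw [← hx]
  -- The preferred chart of `T*M` depends only on the base point, so the chart at `α` is also the
  -- one centred at `fibreLine α ε t`.
  refine (chartForm_self (basicVolume m f) (fibreLine α ε t) w).trans ?_
  exact basicVolume_eq_of_fst_eq (α := fibreLine α ε t) (β := α) f rfl w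

/-- Such an endomorphism squares to zero, and nilpotent maps have trace zero. -/
theorem trace_eq_zero_of_vertical {P : Type*} [AddCommGroup P] [Module ℝ P]
    [FiniteDimensional ℝ P] {R : Type*} [AddCommGroup R] [Module ℝ R] [FiniteDimensional ℝ R]
    (B : P →ₗ[ℝ] R) :
    LinearMap.trace ℝ (P × R) ((LinearMap.inr ℝ P R) ∘ₗ B ∘ₗ LinearMap.fst ℝ P R) = 0 := by
  refine (LinearMap.isNilpotent_trace_of_isNilpotent ⟨2, ?_⟩).eq_zero
  ext <;> simp [pow_two]

theorem nonempty_basis_cotangent : Nonempty (Module.Basis (Fin m × Fin 2) ℝ (Eu m × (Eu m →L[ℝ] ℝ))) := by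
  have h : Module.finrank ℝ (Eu m →L[ℝ] ℝ) = m := by
    rw [← (LinearMap.toContinuousLinearMap (𝕜 := ℝ) (E := Eu m) (F' := ℝ)).finrank_eq]
    exact (Subspace.dual_finrank_eq).trans (finrank_euclideanSpace_fin)
  refine ⟨(Module.finBasisOfFinrankEq ℝ (Eu m × (Eu m →L[ℝ] ℝ)) (n := m * 2) ?_).reindex
    finProdFinEquiv.symm⟩
  rw [Module.finrank_prod, h, finrank_euclideanSpace_fin]
  ring

theorem lieDerivForm_force_basicVolume {v : M → ℝ} (hv : ContMDiff (𝓡 m) 𝓘(ℝ, ℝ) ∞ v) (f : M → ℝ)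
    (α : Cotangent m M) (w : Fin m × Fin 2 → TangentSpace (cotModel m) α) :
    lieDerivForm (cotModel m) (force v) (basicVolume m f) α w = 0 := by
  have hr : range (cotModel m) = univ := (cotModel m).range_eq_univ
  set y₀ := extChartAt (cotModel m) α α with hy₀
  rw [lieDerivForm_eq, hr, fderivWithin_univ, fderivWithin_univ, ← hy₀,
    chartField_force hv α (mem_extChartAt_target α)]
  -- The field points along the fibre, where the coordinate expression of the volume is constant.
  have h1 : fderiv ℝ (fun y => chartForm (basicVolume m f) α y (chartVec α w)) y₀
      ((0, -fderiv ℝ (v ∘ (extChartAt (𝓡 m) α.1).symm) y₀.1) : Eu m × (Eu m →L[ℝ] ℝ)) = 0 := by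
    refine fderiv_apply_eq_zero_of_const_line fun t => ?_
    exact (chartForm_basicVolume_add_smul f α _ t _).trans (chartForm_self _ α _).symm
  -- The Jacobian is minus the Hessian of `v`, sending base directions to fibre directions.
  have h2 : HasFDerivAt (chartField (force v) α)
      ((ContinuousLinearMap.inr ℝ (Eu m) (Eu m →L[ℝ] ℝ)).comp
        ((-fderiv ℝ (fun q => fderiv ℝ (v ∘ (extChartAt (𝓡 m) α.1).symm) q) y₀.1).comp
          (ContinuousLinearMap.fst ℝ (Eu m) (Eu m →L[ℝ] ℝ)))) y₀ := by
    refine HasFDerivAt.congr_of_eventuallyEq ?_ (chartField_force_eventuallyEq hv α)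
    have h3 : HasFDerivAt (fun q => fderiv ℝ (v ∘ (extChartAt (𝓡 m) α.1).symm) q)
        (fderiv ℝ (fun q => fderiv ℝ (v ∘ (extChartAt (𝓡 m) α.1).symm) q) y₀.1) y₀.1 := by
      refine DifferentiableAt.hasFDerivAt ?_
      rw [hy₀, extChartAt_cotangent_apply α α (mem_chart_source _ _)]
      exact (contDiffAt_fderiv_chart hv α).differentiableAt (by simp)
    exact (ContinuousLinearMap.inr ℝ (Eu m) (Eu m →L[ℝ] ℝ)).hasFDerivAt.comp y₀
      (h3.neg.comp y₀ hasFDerivAt_fst)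
  obtain ⟨b⟩ := nonempty_basis_cotangent (m := m)
  rw [h1, h2.fderiv, zero_add]
  refine ((chartForm (basicVolume m f) α y₀).sum_update_eq_trace_smul b
    (LinearMap.inr ℝ (Eu m) (Eu m →L[ℝ] ℝ) ∘ₗ
      (-fderiv ℝ (fun q => fderiv ℝ (v ∘ (extChartAt (𝓡 m) α.1).symm) q) y₀.1).toLinearMap ∘ₗ
        LinearMap.fst ℝ (Eu m) (Eu m →L[ℝ] ℝ)) (chartVec α w)).trans ?_
  rw [trace_eq_zero_of_vertical, zero_mul]

end Cotangent

/-! ### Invertibility of positive definite forms, and the constrained kinetic energy. -/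

theorem isInvertible_of_injective {V W : Type*} [AddCommGroup V] [Module ℝ V] [TopologicalSpace V]
    [IsTopologicalAddGroup V] [ContinuousSMul ℝ V] [T2Space V] [FiniteDimensional ℝ V]
    [AddCommGroup W] [Module ℝ W] [TopologicalSpace W]
    [IsTopologicalAddGroup W] [ContinuousSMul ℝ W] [T2Space W] [FiniteDimensional ℝ W]
    {A : V →L[ℝ] W} (h : Function.Injective A) (hd : Module.finrank ℝ V = Module.finrank ℝ W) :
    A.IsInvertible :=
  ⟨(LinearEquiv.ofInjectiveOfFinrankEq A.toLinearMap h hd).toContinuousLinearEquiv, by ext; rfl⟩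

section LinearAlgebra

variable {W : Type*} [AddCommGroup W] [Module ℝ W] [TopologicalSpace W]
    [IsTopologicalAddGroup W] [ContinuousSMul ℝ W] [T2Space W] [FiniteDimensional ℝ W]

/-- The restriction of a bilinear form along a linear map. -/
def restrictForm {P : Type*} [AddCommGroup P] [Module ℝ P] [TopologicalSpace P]
    [IsTopologicalAddGroup P] [ContinuousSMul ℝ P] (g : W →L[ℝ] W →L[ℝ] ℝ) (E : P →L[ℝ] W) :
    P →L[ℝ] P →L[ℝ] ℝ :=
  ((ContinuousLinearMap.precomp ℝ E).comp g).comp E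

theorem isInvertible_of_posDef (g : W →L[ℝ] W →L[ℝ] ℝ) (hg : ∀ v, v ≠ 0 → 0 < g v v) :
    g.IsInvertible := by
  refine isInvertible_of_injective ?_ ?_
  · refine (injective_iff_map_eq_zero g).2 fun v hv => ?_
    by_contra h
    have := hg v h
    rw [hv] at this
    simp at this
  · rw [← (LinearMap.toContinuousLinearMap (𝕜 := ℝ) (E := W) (F' := ℝ)).finrank_eq]
    exact (Subspace.dual_finrank_eq).symm

omit [IsTopologicalAddGroup W] [ContinuousSMul ℝ W] [T2Space W] [FiniteDimensional ℝ W] in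
theorem isInvertible_restrictForm {P : Type*} [AddCommGroup P] [Module ℝ P] [TopologicalSpace P]
    [IsTopologicalAddGroup P] [ContinuousSMul ℝ P] [T2Space P] [FiniteDimensional ℝ P]
    (g : W →L[ℝ] W →L[ℝ] ℝ) (hg : ∀ v, v ≠ 0 → 0 < g v v) {E : P →L[ℝ] W}
    (hE : Function.Injective E) : (restrictForm g E).IsInvertible :=
  isInvertible_of_posDef _ fun v hv => hg (E v) (by rwa [ne_eq, map_eq_zero_iff E hE])

/-- Let `d` in `D` represent `b` for the restricted metric. Then `𝒫^* b = g d`, so its squared norm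
is `g d d = b d`. -/
theorem proj_norm_sq (g : W →L[ℝ] W →L[ℝ] ℝ) (hs : ∀ v w, g v w = g w v)
    (hg : ∀ v, v ≠ 0 → 0 < g v v) (D : Submodule ℝ W) (b : D →L[ℝ] ℝ) :
    (b.comp ((restrictForm g D.subtypeL).inverse.comp
      ((ContinuousLinearMap.precomp ℝ D.subtypeL).comp g)))
      (g.inverse (b.comp ((restrictForm g D.subtypeL).inverse.comp
        ((ContinuousLinearMap.precomp ℝ D.subtypeL).comp g)))) =
      b ((restrictForm g D.subtypeL).inverse b) := by
  have hA := isInvertible_restrictForm g hg (E := D.subtypeL) Subtype.val_injective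
  have hG := isInvertible_of_posDef g hg
  set A := restrictForm g D.subtypeL with hAdef
  set d := A.inverse b with hd
  have hb : b = A d := (hA.self_apply_inverse b).symm
  have hξ : b.comp (A.inverse.comp ((ContinuousLinearMap.precomp ℝ D.subtypeL).comp g)) = g d := by
    ext v
    have h1 : A (A.inverse ((ContinuousLinearMap.precomp ℝ D.subtypeL) (g v))) d = g v d := by
      rw [hA.self_apply_inverse]
      rfl
    rw [hs d v, ← h1, hb]
    exact hs _ _
  rw [hξ, hG.inverse_apply_self, hb]
  rfl

/-- Replaces the varying space `D` by a fixed parameter space `P`, so that smooth dependence on the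
base point becomes a statement about operators between fixed spaces. -/
theorem restrictForm_inverse_apply {P : Type*} [AddCommGroup P] [Module ℝ P] [TopologicalSpace P]
    [IsTopologicalAddGroup P] [ContinuousSMul ℝ P] [T2Space P] [FiniteDimensional ℝ P]
    (g : W →L[ℝ] W →L[ℝ] ℝ) (hg : ∀ v, v ≠ 0 → 0 < g v v) (D : Submodule ℝ W) (e : P ≃L[ℝ] D)
    (b : D →L[ℝ] ℝ) :
    b ((restrictForm g D.subtypeL).inverse b) = (b.comp e.toContinuousLinearMap)
      ((restrictForm g (D.subtypeL.comp e.toContinuousLinearMap)).inverse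
        (b.comp e.toContinuousLinearMap)) := by
  have hA := isInvertible_restrictForm g hg (E := D.subtypeL) Subtype.val_injective
  have hB := isInvertible_restrictForm g hg (E := D.subtypeL.comp e.toContinuousLinearMap)
    (Subtype.val_injective.comp e.injective)
  have h : (restrictForm g (D.subtypeL.comp e.toContinuousLinearMap)).inverse
      (b.comp e.toContinuousLinearMap) = e.symm ((restrictForm g D.subtypeL).inverse b) := by
    rw [hB.inverse_apply_eq]
    ext p
    have h1 : restrictForm g D.subtypeL ((restrictForm g D.subtypeL).inverse b) (e p) = b (e p) := by
      rw [hA.self_apply_inverse]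
    refine h1.symm.trans ?_
    simp [restrictForm]
  rw [h]
  simp

end LinearAlgebra

/-! ### Smoothness criteria: operators tested on a basis, functions on the base of a submersion. -/

theorem contMDiffAt_clm_of_forall_single {EM HM M : Type*} [NormedAddCommGroup EM] [NormedSpace ℝ EM]
    [TopologicalSpace HM] {I : ModelWithCorners ℝ EM HM} [TopologicalSpace M] [ChartedSpace HM M]
    {r : ℕ} {F : Type*} [NormedAddCommGroup F] [NormedSpace ℝ F] {f : M → Eu r →L[ℝ] F} {x : M}
    (h : ∀ i, ContMDiffAt I 𝓘(ℝ, F) ∞ (fun y => f y (EuclideanSpace.single i 1)) x) :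
    ContMDiffAt I 𝓘(ℝ, Eu r →L[ℝ] F) ∞ f x := by
  have hf : f = fun y => ∑ i, ContinuousLinearMap.smulRightL ℝ (Eu r) F
      (EuclideanSpace.proj i) (f y (EuclideanSpace.single i 1)) := by
    funext y
    ext a
    conv_lhs => rw [← (EuclideanSpace.basisFun (Fin r) ℝ).sum_repr a]
    simp
  rw [hf]
  refine ContMDiffAt.sum fun i _ => ?_
  exact (ContinuousLinearMap.smulRightL ℝ (Eu r) F
      (EuclideanSpace.proj i)).contMDiff.contMDiffAt.comp x (h i)

/-- In adapted charts a submersion is a linear projection. The section keeps the complementary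
coordinate frozen at its value at `q`; away from `p q` the values of `σ` carry no meaning. -/
theorem exists_localSection {n r : ℕ} {Q S : Type*}
    [TopologicalSpace Q] [ChartedSpace (Eu n) Q] [TopologicalSpace S] [ChartedSpace (Eu r) S]
    {p : Q → S} (hp : Manifold.IsSubmersion (𝓡 n) (𝓡 r) ∞ p) (q : Q) :
    ∃ σ : S → Q, ContMDiffAt (𝓡 r) (𝓡 n) ∞ σ (p q) ∧ σ (p q) = q ∧ ∀ᶠ s in 𝓝 (p q), p (σ s) = s := by
  obtain ⟨F, _, _, h⟩ := hp
  have hq := h q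
  set φ := hq.domChart
  set ψ := hq.codChart
  have hxφ : q ∈ (φ.extend (𝓡 n)).source := by
    rw [φ.extend_source]; exact hq.mem_domChart_source
  have hxψ : p q ∈ (ψ.extend (𝓡 r)).source := by
    rw [ψ.extend_source]; exact hq.mem_codChart_source
  let k : S → Eu n := fun s => hq.equiv.symm (ψ.extend (𝓡 r) s, (hq.equiv (φ.extend (𝓡 n) q)).2)
  have hk0 : k (p q) = φ.extend (𝓡 n) q := by
    have h1 := hq.writtenInCharts ((φ.extend (𝓡 n)).map_source hxφ)
    have h2 : ψ.extend (𝓡 r) (p q) = (hq.equiv (φ.extend (𝓡 n) q)).1 :=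
      (congrArg (fun x => ψ.extend (𝓡 r) (p x)) ((φ.extend (𝓡 n)).left_inv hxφ)).symm.trans h1
    simp only [k]
    rw [h2]
    simp
  have hk : ContMDiffAt (𝓡 r) 𝓘(ℝ, Eu n) ∞ k (p q) := by
    have h1 : ContMDiffAt (𝓡 r) 𝓘(ℝ, Eu r) ∞ (ψ.extend (𝓡 r)) (p q) :=
      OpenPartialHomeomorph.contMDiffAt_extend hq.codChart_mem_maximalAtlas hq.mem_codChart_source
    have h2 : ContDiff ℝ ∞ (fun a : Eu r => hq.equiv.symm (a, (hq.equiv (φ.extend (𝓡 n) q)).2)) :=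
      hq.equiv.symm.contDiff.comp (contDiff_id.prodMk contDiff_const)
    exact h2.contMDiff.contMDiffAt.comp (p q) h1
  have ht : (φ.extend (𝓡 n)).target ∈ 𝓝 (k (p q)) := by
    rw [hk0]
    exact φ.isOpen_extend_target.mem_nhds ((φ.extend (𝓡 n)).map_source hxφ)
  refine ⟨fun s => (φ.extend (𝓡 n)).symm (k s), ?_, ?_, ?_⟩
  · have h3 := contMDiffOn_extend_symm (I := 𝓡 n) hq.domChart_mem_maximalAtlas
    rw [← OpenPartialHomeomorph.extend_target'] at h3
    exact (h3.contMDiffAt ht).comp (p q) hk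
  · simp only [hk0]
    exact (φ.extend (𝓡 n)).left_inv hxφ
  · filter_upwards [hk.continuousAt ht, ψ.extend_source_mem_nhds (I := 𝓡 r) hq.mem_codChart_source]
      with s hs hs'
    have h1 := hq.writtenInCharts hs
    simp only [Function.comp_apply, k, ContinuousLinearEquiv.apply_symm_apply] at h1
    refine (ψ.extend (𝓡 r)).injOn ?_ hs' h1
    rw [ψ.extend_source]
    refine hq.mapsto_domChart_source_codChart_source ?_
    have := (φ.extend (𝓡 n)).map_target hs
    rwa [φ.extend_source] at this

section Submersion

variable {n r : ℕ} {Q S : Type*}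
    [TopologicalSpace Q] [ChartedSpace (Eu n) Q] [IsManifold (𝓡 n) ∞ Q]
    [TopologicalSpace S] [ChartedSpace (Eu r) S] [IsManifold (𝓡 r) ∞ S]
    {p : Q → S}

omit [IsManifold (𝓡 n) ∞ Q] [IsManifold (𝓡 r) ∞ S] in
theorem mfderiv_surjective_of_isSubmersion (hp : Manifold.IsSubmersion (𝓡 n) (𝓡 r) ∞ p) (q : Q) :
    Function.Surjective (mfderiv (𝓡 n) (𝓡 r) p q) := by
  obtain ⟨σ, hσ, h0, h1⟩ := exists_localSection hp q
  suffices h : Function.Surjective (mfderiv (𝓡 n) (𝓡 r) p (σ (p q))) by rwa [h0] at h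
  intro w
  have hσ' := hσ.mdifferentiableAt (by simp)
  have hp' : MDifferentiableAt (𝓡 n) (𝓡 r) p (σ (p q)) :=
    hp.contMDiff.mdifferentiable (by simp) _
  have h2 : mfderiv (𝓡 r) (𝓡 r) (p ∘ σ) (p q) w = w := by
    have h3 : p ∘ σ =ᶠ[𝓝 (p q)] id := h1
    rw [h3.mfderiv_eq, mfderiv_id]
    rfl
  exact ⟨mfderiv (𝓡 r) (𝓡 n) σ (p q) w, (mfderiv_comp_apply (p q) hp' hσ' w).symm.trans h2⟩

omit [IsManifold (𝓡 n) ∞ Q] [IsManifold (𝓡 r) ∞ S] in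
theorem contMDiff_of_comp_submersion (hp : Manifold.IsSubmersion (𝓡 n) (𝓡 r) ∞ p)
    (hs : Function.Surjective p) {v : S → ℝ} (hv : ContMDiff (𝓡 n) 𝓘(ℝ, ℝ) ∞ (v ∘ p)) :
    ContMDiff (𝓡 r) 𝓘(ℝ, ℝ) ∞ v := by
  intro s
  obtain ⟨q, rfl⟩ := hs s
  obtain ⟨σ, hσ, h0, h1⟩ := exists_localSection hp q
  refine (hv.contMDiffAt.comp (p q) hσ).congr_of_eventuallyEq ?_
  filter_upwards [h1] with s hs
  simp [hs]

end Submersion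

/-! ### The Chaplygin condition makes `Tπ` an isomorphism on `D`. -/

namespace System

variable {n d r : ℕ} {Q G S : Type*}
  [TopologicalSpace Q] [ChartedSpace (Eu n) Q] [IsManifold (𝓡 n) ∞ Q]
  [TopologicalSpace G] [ChartedSpace (Eu d) G] [Group G] [MulAction G Q]
  [TopologicalSpace S] [ChartedSpace (Eu r) S] [IsManifold (𝓡 r) ∞ S]
  (C : System n d r Q G S)

omit [IsManifold (𝓡 r) ∞ S] in
theorem finrank_D (q : Q) : Module.finrank ℝ (C.D q) = r := by
  obtain ⟨N, e, -, hq, -, h⟩ := C.D_smooth q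
  rw [← (h q hq).2, finrank_span_eq_card (h q hq).1, Fintype.card_fin]

instance (q : Q) : FiniteDimensional ℝ (TangentSpace (𝓡 n) q) :=
  inferInstanceAs (FiniteDimensional ℝ (Eu n))

instance (q : Q) : T2Space (TangentSpace (𝓡 n) q) :=
  inferInstanceAs (T2Space (Eu n))

omit [IsManifold (𝓡 r) ∞ S] in
theorem isInvertible_mfderiv_comp_subtype [ContMDiffSMul (𝓡 d) (𝓡 n) ∞ G Q] (q : Q) :
    ((mfderiv (𝓡 n) (𝓡 r) C.π q).comp (C.D q).subtypeL).IsInvertible := by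
  suffices h : ∀ q, Function.Surjective ((mfderiv (𝓡 n) (𝓡 r) C.π q).comp (C.D q).subtypeL) by
    have hd : Module.finrank ℝ (C.D q) = Module.finrank ℝ (TangentSpace (𝓡 r) (C.π q)) :=
      (C.finrank_D q).trans (finrank_euclideanSpace_fin).symm
    refine isInvertible_of_injective ?_ hd
    exact (LinearMap.injective_iff_surjective_of_finrank_eq_finrank hd).2 (h q)
  clear q
  intro q
  -- The orbit map at `1` takes the value `1 • q`, so `splitting` is a statement about the tangent
  -- space there.
  rw [← one_smul G q]
  have hsurj := mfderiv_surjective_of_isSubmersion C.π_submersion ((1 : G) • q)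
  have ho : MDifferentiableAt (𝓡 d) (𝓡 n) (fun g : G => g • q) 1 := by
    have : ContMDiff (𝓡 d) (𝓡 n) ∞ (fun g : G => g • q) :=
      (contMDiff_id : ContMDiff (𝓡 d) (𝓡 d) ∞ (id : G → G)).smul contMDiff_const
    exact this.mdifferentiable (by simp) _
  have hp : MDifferentiableAt (𝓡 n) (𝓡 r) C.π ((1 : G) • q) :=
    C.π_submersion.contMDiff.mdifferentiable (by simp) _
  -- `π` is constant on orbits, so `Tπ` kills `𝔤·q`, and surjectivity of `Tπ` passes to its
  -- restriction to `D`.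
  have h0 : ∀ u, mfderiv (𝓡 n) (𝓡 r) C.π ((1 : G) • q)
      (mfderiv (𝓡 d) (𝓡 n) (fun g : G => g • q) 1 u) = 0 := by
    intro u
    rw [← mfderiv_comp_apply (1 : G) hp ho u]
    have hc : C.π ∘ (fun g : G => g • q) = fun _ => C.π q := by
      funext g
      exact ((C.π_eq_iff _ _).2 ⟨g, rfl⟩).symm
    rw [hc, mfderiv_const]
    rfl
  intro w
  obtain ⟨u, rfl⟩ := hsurj w
  obtain ⟨a, ha, b, ⟨c, rfl⟩, rfl⟩ := Submodule.mem_sup.1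
    ((C.splitting q).sup_eq_top.symm ▸ Submodule.mem_top : u ∈ C.D ((1 : G) • q) ⊔
      (LinearMap.range (mfderiv (𝓡 d) (𝓡 n) (fun g : G => g • q) 1).toLinearMap))
  refine ⟨⟨a, ha⟩, ?_⟩
  rw [map_add]
  refine (add_zero _).symm.trans (congrArg₂ (· + ·) rfl (h0 c).symm)

end System

/-! ### Local frames of `D` and smoothness of the constrained Hamiltonian. -/

namespace System

variable {n d r : ℕ} {Q G S : Type*}
  [TopologicalSpace Q] [ChartedSpace (Eu n) Q] [IsManifold (𝓡 n) ∞ Q]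
  [TopologicalSpace G] [ChartedSpace (Eu d) G] [Group G] [MulAction G Q]
  [TopologicalSpace S] [ChartedSpace (Eu r) S]
  (C : System n d r Q G S)

/-- A family of linear maps `e q : ℝʳ → T_qQ` that is a smooth frame of `D` near `q₀`. -/
structure IsFrameAt (q₀ : Q) (e : (q : Q) → Eu r →L[ℝ] TangentSpace (𝓡 n) q) : Prop where
  smooth : ∀ i, ContMDiffAt (𝓡 n) (𝓡 n).tangent ∞
    (fun q => (⟨q, e q (EuclideanSpace.single i 1)⟩ : TangentBundle (𝓡 n) Q)) q₀
  exists_equiv : ∀ᶠ q in 𝓝 q₀, ∃ E : Eu r ≃L[ℝ] C.D q,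
    e q = (C.D q).subtypeL.comp E.toContinuousLinearMap

theorem exists_isFrameAt (q₀ : Q) : ∃ e, C.IsFrameAt q₀ e := by
  obtain ⟨N, e, hN, hq, he, h⟩ := C.D_smooth q₀
  let e' : (q : Q) → Eu r →L[ℝ] TangentSpace (𝓡 n) q := fun q => LinearMap.toContinuousLinearMap
    ((EuclideanSpace.basisFun (Fin r) ℝ).toBasis.constr ℝ (fun i => e i q))
  have he' : ∀ q i, e' q (EuclideanSpace.single i 1) = e i q := fun q i => by
    have := (EuclideanSpace.basisFun (Fin r) ℝ).toBasis.constr_basis ℝ (fun i => e i q) i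
    rw [OrthonormalBasis.coe_toBasis, EuclideanSpace.basisFun_apply] at this
    exact this
  refine ⟨e', fun i => ?_, ?_⟩
  · simp only [he']
    exact (he i).contMDiffAt (hN.mem_nhds hq)
  · filter_upwards [hN.mem_nhds hq] with q hqN
    have hr : (e' q).range = C.D q := by
      rw [← (h q hqN).2]
      exact (EuclideanSpace.basisFun (Fin r) ℝ).toBasis.constr_range ℝ
    let E := (e' q).codRestrict (C.D q) (fun a => hr ▸ LinearMap.mem_range_self _ a)
    have hd : Module.finrank ℝ (Eu r) = Module.finrank ℝ (C.D q) :=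
      (finrank_euclideanSpace_fin).trans (C.finrank_D q).symm
    have hsurj : Function.Surjective E.toLinearMap := by
      rintro ⟨u, hu⟩
      rw [← hr] at hu
      obtain ⟨a, rfl⟩ := hu
      exact ⟨a, rfl⟩
    obtain ⟨E', hE'⟩ : E.IsInvertible := isInvertible_of_injective
      ((LinearMap.injective_iff_surjective_of_finrank_eq_finrank hd).2 hsurj) hd
    refine ⟨E', ?_⟩
    rw [hE']
    rfl

variable {C} {q₀ : Q} {e : (q : Q) → Eu r →L[ℝ] TangentSpace (𝓡 n) q}

theorem IsFrameAt.contMDiffAt_covector_comp (h : C.IsFrameAt q₀ e) {β₀ : Cotangent n Q}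
    (hβ : β₀.1 = q₀) :
    ContMDiffAt (cotModel n) 𝓘(ℝ, Eu r →L[ℝ] ℝ) ∞
      (fun β : Cotangent n Q => ContinuousLinearMap.comp β.2 (e β.1)) β₀ := by
  subst hβ
  refine contMDiffAt_clm_of_forall_single fun i => ?_
  have h1 := ContMDiffAt.clm_bundle_apply (n := ∞) (F₁ := Eu n) (F₂ := ℝ) (IB := 𝓡 n)
    (E₁ := fun q : Q => TangentSpace (𝓡 n) q)
    (E₂ := Trivial Q ℝ) (b := fun β : Cotangent n Q => β.1) (ϕ := fun β => β.2)
    (v := fun β => e β.1 (EuclideanSpace.single i 1)) (IM := cotModel n) (x := β₀) contMDiffAt_id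
    ((h.smooth i).comp β₀ (contMDiffAt_proj _))
  exact (contMDiffAt_totalSpace.1 h1).2

theorem IsFrameAt.contMDiffAt_restrictForm (h : C.IsFrameAt q₀ e) :
    ContMDiffAt (𝓡 n) 𝓘(ℝ, Eu r →L[ℝ] Eu r →L[ℝ] ℝ) ∞
      (fun q => restrictForm (C.metric.inner q) (e q)) q₀ := by
  refine contMDiffAt_clm_of_forall_single fun i => contMDiffAt_clm_of_forall_single fun j => ?_
  have h1 := ContMDiffAt.clm_bundle_apply₂ (n := ∞) (F₁ := Eu n) (F₂ := Eu n) (F₃ := ℝ) (IB := 𝓡 n)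
    (E₁ := fun q : Q => TangentSpace (𝓡 n) q) (E₂ := fun q : Q => TangentSpace (𝓡 n) q)
    (E₃ := Trivial Q ℝ) (b := fun q : Q => q) (ψ := fun q => C.metric.inner q)
    (v := fun q => e q (EuclideanSpace.single i 1)) (w := fun q => e q (EuclideanSpace.single j 1))
    (IM := 𝓡 n) (x := q₀) C.metric.contMDiff.contMDiffAt (h.smooth i) (h.smooth j)
  exact (contMDiffAt_totalSpace.1 h1).2

/-- The constrained Hamiltonian in a frame. -/
theorem constrainedHamiltonian_restr (β : Cotangent n Q) {E : Eu r ≃L[ℝ] C.D β.1}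
    {ε : Eu r →L[ℝ] TangentSpace (𝓡 n) β.1}
    (hE : ε = (C.D β.1).subtypeL.comp E.toContinuousLinearMap) :
    C.constrainedHamiltonian (C.restr β) = 1 / 2 * (ContinuousLinearMap.comp β.2 ε)
      ((restrictForm (C.metric.inner β.1) ε).inverse (ContinuousLinearMap.comp β.2 ε)) +
      C.potential β.1 := by
  subst hE
  have h1 := proj_norm_sq (C.metric.inner β.1) (C.metric.symm β.1) (C.metric.pos β.1) (C.D β.1)
    (ContinuousLinearMap.comp β.2 (C.D β.1).subtypeL)
  have h2 := restrictForm_inverse_apply (C.metric.inner β.1) (C.metric.pos β.1) (C.D β.1) E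
    (ContinuousLinearMap.comp β.2 (C.D β.1).subtypeL)
  exact congrArg (fun x : ℝ => 1 / 2 * x + C.potential β.1) (h1.trans h2)

variable (C) in
theorem contMDiff_constrainedHamiltonian_comp_restr :
    ContMDiff (cotModel n) 𝓘(ℝ, ℝ) ∞ (C.constrainedHamiltonian ∘ C.restr) := by
  intro β₀
  obtain ⟨e, he⟩ := C.exists_isFrameAt β₀.1
  have hev : ∀ᶠ β : Cotangent n Q in 𝓝 β₀, ∃ E : Eu r ≃L[ℝ] C.D β.1,
      e β.1 = (C.D β.1).subtypeL.comp E.toContinuousLinearMap :=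
    (FiberBundle.continuous_proj _ _).continuousAt.eventually he.exists_equiv
  have hb := he.contMDiffAt_covector_comp (β₀ := β₀) rfl
  have hg : ContMDiffAt (cotModel n) 𝓘(ℝ, Eu r →L[ℝ] Eu r →L[ℝ] ℝ) ∞
      (fun β : Cotangent n Q => restrictForm (C.metric.inner β.1) (e β.1)) β₀ :=
    he.contMDiffAt_restrictForm.comp β₀ (contMDiffAt_proj _)
  have hinv : (restrictForm (C.metric.inner β₀.1) (e β₀.1)).IsInvertible := by
    obtain ⟨E, hE⟩ := hev.self_of_nhds
    refine isInvertible_restrictForm _ (C.metric.pos β₀.1) ?_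
    rw [hE]
    exact Subtype.val_injective.comp E.injective
  -- The Gram form of the frame is positive definite, and inversion is smooth near an invertible
  -- operator.
  have hg' := (hinv.contDiffAt_map_inverse (n := ∞)).contMDiffAt.comp β₀ hg
  have hU : ContMDiffAt (cotModel n) 𝓘(ℝ, ℝ) ∞ (fun β : Cotangent n Q => C.potential β.1) β₀ :=
    C.potential_smooth.contMDiffAt.comp β₀ (contMDiffAt_proj _)
  refine ContMDiffAt.congr_of_eventuallyEq (f := fun β : Cotangent n Q =>
    1 / 2 * (ContinuousLinearMap.comp β.2 (e β.1))
      ((restrictForm (C.metric.inner β.1) (e β.1)).inverse (ContinuousLinearMap.comp β.2 (e β.1))) +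
      C.potential β.1) ?_ ?_
  · exact ((contMDiffAt_const (c := (1 / 2 : ℝ))).mul (hb.clm_apply (hg'.clm_apply hb))).add hU
  · filter_upwards [hev] with β hβ
    obtain ⟨E, hE⟩ := hβ
    exact constrainedHamiltonian_restr β hE

end System

/-! ### The reduction map, its effect on vertical vectors, and the conclusion. -/

namespace System

variable {n d r : ℕ} {Q G S : Type*}
  [TopologicalSpace Q] [ChartedSpace (Eu n) Q] [IsManifold (𝓡 n) ∞ Q]
  [TopologicalSpace G] [ChartedSpace (Eu d) G] [Group G] [MulAction G Q]
  [TopologicalSpace S] [ChartedSpace (Eu r) S] [IsManifold (𝓡 r) ∞ S]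
  (C : System n d r Q G S) {q₀ : Q} {e : (q : Q) → Eu r →L[ℝ] TangentSpace (𝓡 n) q}

/-- The derivative of the orbit projection along a frame, in a trivialization of `TS`. -/
def frameDeriv (e : (q : Q) → Eu r →L[ℝ] TangentSpace (𝓡 n) q) (q₀ q : Q) : Eu r →L[ℝ] Eu r :=
  ((trivializationAt (Eu r) (TangentSpace (𝓡 r)) (C.π q₀)).continuousLinearMapAt ℝ (C.π q)).comp
    ((mfderiv (𝓡 n) (𝓡 r) C.π q).comp (e q))

variable {C}

theorem IsFrameAt.contMDiffAt_frameDeriv (h : C.IsFrameAt q₀ e) :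
    ContMDiffAt (𝓡 n) 𝓘(ℝ, Eu r →L[ℝ] Eu r) ∞ (C.frameDeriv e q₀) q₀ := by
  refine contMDiffAt_clm_of_forall_single fun i => ?_
  have h1 : ContMDiffAt (𝓡 n) (𝓡 r).tangent ∞ (fun q => tangentMap (𝓡 n) (𝓡 r) C.π
      (⟨q, e q (EuclideanSpace.single i 1)⟩ : TangentBundle (𝓡 n) Q)) q₀ :=
    (C.π_submersion.contMDiff.contMDiff_tangentMap (m := ∞) (by simp)).contMDiffAt.comp q₀
      (h.smooth i)
  refine (contMDiffAt_totalSpace.1 h1).2.congr_of_eventuallyEq ?_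
  have h2 : ∀ᶠ q in 𝓝 q₀, C.π q ∈
      (trivializationAt (Eu r) (TangentSpace (𝓡 r)) (C.π q₀)).baseSet :=
    C.π_submersion.contMDiff.continuous.continuousAt.eventually
      ((trivializationAt (Eu r) (TangentSpace (𝓡 r)) (C.π q₀)).open_baseSet.mem_nhds
        (FiberBundle.mem_baseSet_trivializationAt' (C.π q₀)))
  filter_upwards [h2] with q hq
  exact congrFun ((trivializationAt (Eu r) (TangentSpace (𝓡 r)) (C.π q₀)).coe_continuousLinearEquivAt_eq
    (R := ℝ) hq).symm _

theorem frameDeriv_eq {q : Q} (q₀ : Q)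
    (hq : C.π q ∈ (trivializationAt (Eu r) (TangentSpace (𝓡 r)) (C.π q₀)).baseSet)
    {E : Eu r ≃L[ℝ] C.D q} (hE : e q = (C.D q).subtypeL.comp E.toContinuousLinearMap) :
    C.frameDeriv e q₀ q =
      ((trivializationAt (Eu r) (TangentSpace (𝓡 r)) (C.π q₀)).continuousLinearEquivAt ℝ
        (C.π q) hq).toContinuousLinearMap.comp
        (((mfderiv (𝓡 n) (𝓡 r) C.π q).comp (C.D q).subtypeL).comp E.toContinuousLinearMap) := by
  unfold frameDeriv
  rw [hE, (trivializationAt (Eu r) (TangentSpace (𝓡 r)) (C.π q₀)).coe_continuousLinearEquivAt_eq'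
    (R := ℝ) hq]
  rfl

/-- The reduction map in a frame of `D` and a trivialization of `TS`. -/
theorem comp_hor_comp_symmL (β : Cotangent n Q) (q₀ : Q)
    (hq : C.π β.1 ∈ (trivializationAt (Eu r) (TangentSpace (𝓡 r)) (C.π q₀)).baseSet)
    {E : Eu r ≃L[ℝ] C.D β.1} (hE : e β.1 = (C.D β.1).subtypeL.comp E.toContinuousLinearMap) :
    ((C.restr β).2.comp (C.hor β.1)).comp
      ((trivializationAt (Eu r) (TangentSpace (𝓡 r)) (C.π q₀)).symmL ℝ (C.π β.1)) =
    (ContinuousLinearMap.comp β.2 (e β.1)).comp (C.frameDeriv e q₀ β.1).inverse := by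
  let T := (trivializationAt (Eu r) (TangentSpace (𝓡 r)) (C.π q₀)).continuousLinearEquivAt ℝ
    (C.π β.1) hq
  let X := (mfderiv (𝓡 n) (𝓡 r) C.π β.1).comp (C.D β.1).subtypeL
  have h1 : C.frameDeriv e q₀ β.1 = T.toContinuousLinearMap.comp (X.comp E.toContinuousLinearMap) :=
    frameDeriv_eq q₀ hq hE
  rw [h1, ContinuousLinearMap.inverse_equiv_comp, ContinuousLinearMap.inverse_comp_equiv, hE]
  ext a
  have h2 : ((trivializationAt (Eu r) (TangentSpace (𝓡 r)) (C.π q₀)).symmL ℝ (C.π β.1)) a =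
      T.symm a := congrFun ((trivializationAt (Eu r) (TangentSpace (𝓡 r))
        (C.π q₀)).symm_continuousLinearEquivAt_eq (R := ℝ) hq).symm a
  change β.2 (C.hor β.1 _).1 = β.2 (E (E.symm (X.inverse (T.symm a)))).1
  rw [E.apply_symm_apply]
  exact congrArg (fun u => β.2 (C.hor β.1 u).1) h2

-- With a frame `e` of `D` and a trivialization `T` of `TS`, the fibre part of the map is `(β ∘ e) ∘
-- (T ∘ Tπ ∘ e)⁻¹`, smooth because `T ∘ Tπ ∘ e` is smooth and invertible at the base point.
variable (C) in
theorem contMDiff_reduce_comp_restr [ContMDiffSMul (𝓡 d) (𝓡 n) ∞ G Q] :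
    ContMDiff (cotModel n) (cotModel r) ∞ (C.reduce ∘ C.restr) := by
  intro β₀
  obtain ⟨e, he⟩ := C.exists_isFrameAt β₀.1
  have hev : ∀ᶠ β : Cotangent n Q in 𝓝 β₀, ∃ E : Eu r ≃L[ℝ] C.D β.1,
      e β.1 = (C.D β.1).subtypeL.comp E.toContinuousLinearMap :=
    (FiberBundle.continuous_proj _ _).continuousAt.eventually he.exists_equiv
  have hb := he.contMDiffAt_covector_comp (β₀ := β₀) rfl
  have hg : ContMDiffAt (cotModel n) 𝓘(ℝ, Eu r →L[ℝ] Eu r) ∞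
      (fun β : Cotangent n Q => C.frameDeriv e β₀.1 β.1) β₀ :=
    he.contMDiffAt_frameDeriv.comp β₀ (contMDiffAt_proj _)
  have h2 : ∀ᶠ β : Cotangent n Q in 𝓝 β₀, C.π β.1 ∈
      (trivializationAt (Eu r) (TangentSpace (𝓡 r)) (C.π β₀.1)).baseSet :=
    (C.π_submersion.contMDiff.continuous.comp (FiberBundle.continuous_proj _ _)).continuousAt.eventually
      ((trivializationAt (Eu r) (TangentSpace (𝓡 r)) (C.π β₀.1)).open_baseSet.mem_nhds
        (FiberBundle.mem_baseSet_trivializationAt' (C.π β₀.1)))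
  have hinv : (C.frameDeriv e β₀.1 β₀.1).IsInvertible := by
    obtain ⟨E, hE⟩ := hev.self_of_nhds
    rw [frameDeriv_eq β₀.1 h2.self_of_nhds hE]
    exact (ContinuousLinearMap.isInvertible_equiv).comp
      ((C.isInvertible_mfderiv_comp_subtype β₀.1).comp ContinuousLinearMap.isInvertible_equiv)
  have hg' := (hinv.contDiffAt_map_inverse (n := ∞)).contMDiffAt.comp β₀ hg
  rw [contMDiffAt_hom_bundle]
  refine ⟨C.π_submersion.contMDiff.contMDiffAt.comp β₀ (contMDiffAt_proj _), ?_⟩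
  refine (hb.clm_comp hg').congr_of_eventuallyEq ?_
  filter_upwards [hev, h2] with β hβ hβ2
  obtain ⟨E, hE⟩ := hβ
  refine Eq.trans ?_ (comp_hor_comp_symmL β β₀.1 hβ2 hE)
  ext w
  exact congrArg (fun A : ℝ →L[ℝ] ℝ => A _)
    (Trivial.continuousLinearMapAt_trivialization ℝ S ℝ (C.π β.1))

omit [IsManifold (𝓡 r) ∞ S] in
variable (C) in
theorem restr_projDual (β : C.DDual) : C.restr (C.projDual β) = β := by
  obtain ⟨q, b⟩ := β
  have h := isInvertible_restrictForm (C.metric.inner q) (C.metric.pos q) (E := (C.D q).subtypeL)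
    Subtype.val_injective
  have h1 : (C.proj q).comp (C.D q).subtypeL = ContinuousLinearMap.id ℝ (C.D q) :=
    h.inverse_comp_self
  have h2 : (b.comp (C.proj q)).comp (C.D q).subtypeL = b := by
    rw [ContinuousLinearMap.comp_assoc, h1, ContinuousLinearMap.comp_id]
  exact congrArg (Sigma.mk q) h2

-- Reduction is linear on fibres, and `d(v ∘ π) ∘ hor = dv ∘ Tπ ∘ hor = dv`. This is where
-- invariance of the potential enters the dynamics.
omit [IsManifold (𝓡 r) ∞ S] in
variable (C) in
theorem reduce_restr_fibreLine [ContMDiffSMul (𝓡 d) (𝓡 n) ∞ G Q] (β : Cotangent n Q) {v : S → ℝ}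
    (hv : MDifferentiable (𝓡 r) 𝓘(ℝ, ℝ) v) (t : ℝ) :
    C.reduce (C.restr (fibreLine β (-covec (v ∘ C.π) β.1) t)) =
      fibreLine (C.reduce (C.restr β)) (-covec v (C.π β.1)) t := by
  have hX := C.isInvertible_mfderiv_comp_subtype β.1
  have h1 : covec (v ∘ C.π) β.1 = (covec v (C.π β.1)).comp (mfderiv (𝓡 n) (𝓡 r) C.π β.1) :=
    mfderiv_comp β.1 (hv _) (C.π_submersion.contMDiff.mdifferentiable (by simp) _)
  refine congrArg (fun p => (⟨C.π β.1, p⟩ : Cotangent r S)) ?_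
  ext a
  have h2 : mfderiv (𝓡 n) (𝓡 r) C.π β.1 (C.hor β.1 a).1 = a := hX.self_apply_inverse a
  change β.2 (C.hor β.1 a).1 + t * -(covec (v ∘ C.π) β.1 (C.hor β.1 a).1) =
    β.2 (C.hor β.1 a).1 + t * -(covec v (C.π β.1) a)
  rw [h1]
  change _ + t * -(covec v (C.π β.1) (mfderiv (𝓡 n) (𝓡 r) C.π β.1 (C.hor β.1 a).1)) = _
  rw [h2]

-- Differentiating the equality of lines at `t = 0` gives the action on vertical vectors without
-- computing the tangent map of the reduction.
variable (C) in
theorem diffAt_comp_reduce_comp_restr [ContMDiffSMul (𝓡 d) (𝓡 n) ∞ G Q] (β : Cotangent n Q)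
    {v : S → ℝ} (hv : MDifferentiable (𝓡 r) 𝓘(ℝ, ℝ) v) {φ : Cotangent r S → ℝ}
    (hφ : ContMDiff (cotModel r) 𝓘(ℝ, ℝ) ∞ φ) :
    diffAt (φ ∘ C.reduce ∘ C.restr) β (vertical β (-covec (v ∘ C.π) β.1)) =
      diffAt φ (C.reduce (C.restr β)) (force v (C.reduce (C.restr β))) := by
  have hF : ContMDiff (cotModel n) 𝓘(ℝ, ℝ) ∞ (φ ∘ C.reduce ∘ C.restr) :=
    hφ.comp C.contMDiff_reduce_comp_restr
  have h1 := hasDerivAt_comp_fibreLine (hF.mdifferentiable (by simp) β) (-covec (v ∘ C.π) β.1)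
  have h2 := hasDerivAt_comp_fibreLine (hφ.mdifferentiable (by simp) (C.reduce (C.restr β)))
    (-covec v (C.π β.1))
  simp only [Function.comp_apply, C.reduce_restr_fibreLine β hv] at h1
  exact h1.unique h2

variable (C) in
/-- Adding an invariant potential does not affect the preservation of a basic measure. -/
theorem preservesVolume_addPotential [ContMDiffSMul (𝓡 d) (𝓡 n) ∞ G Q]
    {V : Q → ℝ} (hV : ContMDiff (𝓡 n) 𝓘(ℝ, ℝ) ∞ V) (hVG : ∀ (g : G) (q : Q), V (g • q) = V q)
    {f : S → ℝ} (hpres : C.PreservesVolume (basicVolume r f)) :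
    (C.addPotential V hV hVG).PreservesVolume (basicVolume r f) := by
  obtain ⟨X, ⟨hXs, hXd⟩, hX⟩ := hpres
  -- The value of `v` is that of `V` at a chosen point of the orbit; invariance makes the choice
  -- immaterial.
  obtain ⟨v, rfl⟩ : ∃ v : S → ℝ, V = v ∘ C.π := by
    refine ⟨fun s => V (C.π_surjective s).choose, funext fun q => ?_⟩
    obtain ⟨g, hg⟩ := (C.π_eq_iff _ _).1 (C.π_surjective (C.π q)).choose_spec
    simp only [Function.comp_apply]
    rw [← hVG g (C.π_surjective (C.π q)).choose, hg]
  have hv : ContMDiff (𝓡 r) 𝓘(ℝ, ℝ) ∞ v :=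
    contMDiff_of_comp_submersion C.π_submersion C.π_surjective hV
  refine ⟨X + force v, ⟨hXs.add_section (contMDiff_force hv), fun φ hφ β => ?_⟩, fun α w => ?_⟩
  · have hV' : ∀ a : Cotangent n Q,
        ((C.addPotential (v ∘ C.π) hV hVG).constrainedHamiltonian ∘ C.restr) a =
          (C.constrainedHamiltonian ∘ C.restr) a + (v ∘ C.π) a.1 := fun a =>
      (add_assoc _ _ _).symm
    have h1 : diffAt φ (C.reduce β) (X (C.reduce β)) =
      poisson n ((φ ∘ C.reduce) ∘ C.restr) (C.constrainedHamiltonian ∘ C.restr) (C.projDual β) :=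
      hXd φ hφ β
    have h2 := poisson_add_comp_proj (F := (φ ∘ C.reduce) ∘ C.restr)
      (C.contMDiff_constrainedHamiltonian_comp_restr.mdifferentiable (by simp) (C.projDual β))
      (hV.mdifferentiable (by simp) (C.projDual β).1)
    have h3 := C.diffAt_comp_reduce_comp_restr (C.projDual β) (hv.mdifferentiable (by simp)) hφ
    rw [C.restr_projDual β] at h3
    -- Projector, horizontal lift and reduction do not involve the potential, so those of the new
    -- system are definitionally those of `C`.
    change diffAt φ (C.reduce β) (X (C.reduce β) + force v (C.reduce β)) =
      poisson n ((φ ∘ C.reduce) ∘ C.restr)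
        ((C.addPotential (v ∘ C.π) hV hVG).constrainedHamiltonian ∘ C.restr) (C.projDual β)
    rw [funext hV', h2]
    exact (map_add (diffAt φ (C.reduce β)) _ _).trans (congrArg₂ (· + ·) h1 h3.symm)
  -- Additivity of the Lie derivative needs both fields to be differentiable in the chart.
  · have h1 : ∀ Y : (α : Cotangent r S) → TangentSpace (cotModel r) α,
        ContMDiff (cotModel r) (cotModel r).tangent ∞
          (fun α => (⟨α, Y α⟩ : TangentBundle (cotModel r) (Cotangent r S))) →
        DifferentiableWithinAt ℝ (chartField Y α) (range (cotModel r))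
          (extChartAt (cotModel r) α α) := by
      intro Y hY
      have h2 := VectorField.contMDiffWithinAt_mpullbackWithin_extChartAt_symm (n := ∞)
        (hY.contMDiffAt (x := α)).contMDiffWithinAt uniqueMDiffOn_univ (mem_univ α) (by simp)
      have h3 := (contMDiffWithinAt_vectorSpace_iff_contDiffWithinAt.1 h2)
      rw [preimage_univ, inter_univ] at h3
      exact ((h3.contDiffAt (extChartAt_target_mem_nhds α)).differentiableAt
        (by simp)).differentiableWithinAt
    rw [lieDerivForm_add _ (h1 X hXs) (h1 _ (contMDiff_force hv)), hX,
      lieDerivForm_force_basicVolume hv, add_zero]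

end System

end Chaplygin

end

theorem corollaryC {n d r : ℕ} {Q G S : Type*}
    -- the configuration manifold `Q`, of dimension `n`
    [TopologicalSpace Q] [T2Space Q] [SecondCountableTopology Q]
    [ChartedSpace (EuclideanSpace ℝ (Fin n)) Q] [IsManifold (𝓡 n) ∞ Q]
    -- the Lie group `G`, acting smoothly, freely and properly on `Q`
    [TopologicalSpace G] [T2Space G] [SecondCountableTopology G]
    [ChartedSpace (EuclideanSpace ℝ (Fin d)) G] [Group G] [LieGroup (𝓡 d) ∞ G]
    [MulAction G Q] [ContMDiffSMul (𝓡 d) (𝓡 n) ∞ G Q] [IsCancelSMul G Q] [ProperSMul G Q]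
    -- the shape space `S = Q/G`, of dimension `r`
    [TopologicalSpace S] [T2Space S] [SecondCountableTopology S]
    [ChartedSpace (EuclideanSpace ℝ (Fin r)) S] [IsManifold (𝓡 r) ∞ S]
    -- a Chaplygin system, and a `G`-invariant potential `V`
    (C : Chaplygin.System n d r Q G S)
    (V : Q → ℝ) (hV : ContMDiff (𝓡 n) 𝓘(ℝ, ℝ) ∞ V) (hVG : ∀ (g : G) (q : Q), V (g • q) = V q)
    -- the positive density `f` of a basic measure
    (f : S → ℝ) (hf : ContMDiff (𝓡 r) 𝓘(ℝ, ℝ) ∞ f) (hfpos : ∀ s, 0 < f s)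
    (hpres : C.PreservesVolume (Chaplygin.basicVolume r f)) :
    (C.addPotential V hV hVG).PreservesVolume (Chaplygin.basicVolume r f) :=
  C.preservesVolume_addPotential hV hVG hpres
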